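/- Setting. Quantum variables have type Boolean (state space with computational basis $\{|0\rangle,|1\rangle\}$) or integer (computational basis $\{|n\rangle : n\in\mathbb Z\}$). A finite collection $\bar q$ of variables has state space $\mathcal H_{\bar q}=\bigotimes_{q\in\bar q}\mathcal H_q$, and an operator on some of the variables acts as the identity on the others. A quantum operation (QOP) is a linear, completely positive, trace-non-increasing map on trace-class operators; its dual $\mathcal E^*$ is given by $\mathrm{tr}(A\,\mathcal E(\rho))=\mathrm{tr}(\mathcal E^*(A)\rho)$ for all bounded $A$ and trace-class $\rho$. Operators are compared in the Löwner order, and infinite sums of operators converge weakly. For an increasing sequence of QOPs, $\bigsqcup_n\mathcal E_n$ is the QOP with $(\bigsqcup_n\mathcal E_n)(\rho)=\bigsqcup_n\mathcal E_n(\rho)$ for all $\rho\ge 0$. Programs. Let mutually recursive procedures $\mathsf{proc}_i(\bar y_i)$ with bodies $S_i$ be declared. Statements are $$S ::= \bot \mid \mathsf{skip}\mid q:=|0\rangle\mid \bar q \mathrel{*}= U\mid S;S\mid \mathsf{if}\,(\Box m\cdot M[\bar q]=m\to S_m)\mid \mathsf{local}\ \bar q;S;\mathsf{release}\ \bar q\mid\mathsf{call}\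 \mathsf{proc}_i(\bar a),$$ with $U$ unitary and $\sum_m M_m^\dagger M_m=I$. Statements may use global variables, the formal parameters and the local variables in scope. The approximations of the bodies are $S_i^{(0)}=\bot$, and $S_i^{(k+1)}$ is $S_i$ with every $\mathsf{call}\ \mathsf{proc}_j(\bar p)$ replaced by $\mathsf{skip};S_j^{(k)}[\bar p/\bar y_j]$. A unitary or measurement statement in which a substitution creates a repeated variable fails, i.e. is read as $\bot$. The denotation $[\![S]\!]$ is $$[\![\bot]\!]=0,\quad [\![\mathsf{skip}]\!](\rho)=\rho,\quad [\![q:=|0\rangle]\!](\rho)=\sum_i|0\rangle_q\langle i|\rho|i\rangle_q\langle 0|,\quad [\![\bar q\mathrel{*}=U]\!](\rho)=U\rho U^\dagger,\quad [\![S_1;S_2]\!]=[\![S_2]\!]\circ[\![S_1]\!],$$ $$[\![\mathsf{if}]\!](\rho)=\sum_m[\![S_m]\!](M_m\rho M_m^\dagger),\quad [\![\mathsf{local}\ \bar q;S;\mathsf{release}\ \bar q]\!](\rho)=\mathrm{tr}_{\bar r}\,[\![S[\bar r/\bar q]]\!](\rho\otimes|0\rangle_{\bar r}\langle 0|)\ (\bar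 r\text{ fresh}),\quad [\![\mathsf{call}\ \mathsf{proc}_i(\bar a)]\!]=\bigsqcup_n[\![S_i^{(n)}[\bar a/\bar y_i]]\!].$$ Predicate terms. Quantum predicate variables $X_{\bar q}$ range over operators with $0\le X_{\bar q}\le I$ on $\mathcal H_{\bar q}$. Bases are $\mathcal B ::= X\mid I\otimes\mathcal B\mid\mathcal B\otimes I\mid\mathcal B\otimes\mathcal B'$, tensor products being taken over complementary lists of variables, where $\mathcal B$ and $\mathcal B'$ share no predicate variable. A parameterized quantum predicate term (PQPT) is $P=\mathcal E^*(\mathcal B)+\mathcal F^*(I)$ with QOPs $\mathcal E,\mathcal F$ such that $\mathcal E+\mathcal F$ is trace-non-increasing. An assignment $v$ of quantum predicates to the predicate variables determines the operator $P^v=\mathcal E^*(\mathcal B^v)+\mathcal F^*(I)$. An operator expression below stands for a PQPT, with the same base as $P$, that has the value of this expression under every assignment. If $P_n=\mathcal E_n^*(P')$ for an increasing sequence of QOPs with $\mathcal E=\bigsqcup_n\mathcal E_n$, then $\bigsqcup_nP_n=\mathcal E^*(P')$; if $Q_n=\mathcal E_n^*(P')+(I-\mathcal E_n^*(I))$, then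 $\bigsqcap_nQ_n=\mathcal E^*(P')+(I-\mathcal E^*(I))$. Formal weakest (liberal) preconditions. For $\mathsf{fxp}\in\{\mathsf{fwp},\mathsf{fwlp}\}$, the PQPT $\mathsf{fxp}.S.P$ is defined by $$\mathsf{fwp}.\bot.P=0,\quad\mathsf{fwlp}.\bot.P=I,\quad \mathsf{fxp}.\mathsf{skip}.P=P,\quad \mathsf{fxp}.(q:=|0\rangle).P=\sum_i|i\rangle_q\langle0|P|0\rangle_q\langle i|,\quad \mathsf{fxp}.(\bar q\mathrel{*}=U).P=U^\dagger PU,$$ $$\mathsf{fxp}.(S_1;S_2).P=\mathsf{fxp}.S_1.(\mathsf{fxp}.S_2.P),\quad \mathsf{fxp}.\mathsf{if}.P=\sum_mM_m^\dagger(\mathsf{fxp}.S_m.P)M_m,\quad \mathsf{fxp}.(\mathsf{local}\ \bar q;S;\mathsf{release}\ \bar q).P=\langle0|_{\bar r}\big(\mathsf{fxp}.S[\bar r/\bar q].(P\otimes I_{\bar r})\big)|0\rangle_{\bar r},$$ $$\mathsf{fwp}.(\mathsf{call}\ \mathsf{proc}_i(\bar a)).P=\bigsqcup_n\mathsf{fwp}.S_i^{(n)}[\bar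 a/\bar y_i].P,\qquad \mathsf{fwlp}.(\mathsf{call}\ \mathsf{proc}_i(\bar a)).P=\bigsqcap_n\mathsf{fwlp}.S_i^{(n)}[\bar a/\bar y_i].P.$$ Theorem. For every such statement $S$ and every PQPT $P$, $[\![S]\!]$ is a quantum operation and: (a) $(\mathsf{fwp}.S.P)^v=[\![S]\!]^*(P^v)$ for every assignment $v$; (b) $\mathsf{fwlp}.S.P=I-\mathsf{fwp}.S.(I-P)$ under every assignment. That is, $(\mathsf{fwlp}.S.P)^v=(\mathsf{fwp}.S.P)^v+\big(I-(\mathsf{fwp}.S.I)^v\big)$ for every $v$ (this is the meaning of the right-hand side when $I-P$ is not itself a PQPT), and whenever $N$ is a PQPT with $N^v=I-P^v$ for all $v$, also $(\mathsf{fwlp}.S.P)^v=I-(\mathsf{fwp}.S.N)^v$ for every $v$. -/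

import Mathlib

open scoped ComplexOrder

namespace QHL

noncomputable section

/-! ## Square-summable functions on an index set -/

/-- The Hilbert space with orthonormal (computational) basis indexed by `X`. -/
abbrev Ell (X : Type) : Type := lp (fun _ : X => ℂ) 2

/-- The basis vector `|x⟩`. -/
def ket {X : Type} (x : X) : Ell X := by
  classical exact lp.single 2 x (1 : ℂ)

theorem Ell.hasSum_sq {X : Type} (f : Ell X) : HasSum (fun x => ‖f x‖ ^ 2) (‖f‖ ^ 2) := by
  have h := lp.hasSum_norm (p := 2) (by norm_num) f
  simpa using h

theorem Ell.mem_of_summable {X : Type} {f : X → ℂ} (h : Summable fun x => ‖f x‖ ^ 2) :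
    Memℓp f 2 := by
  refine memℓp_gen ?_
  simpa using h

/-- The coisometry `∑ₓ |x⟩⟨j x|` of an injection `j` of basis indices. -/
def restr {X Y : Type} (j : X → Y) (hj : Function.Injective j) : Ell Y →L[ℂ] Ell X :=
  LinearMap.mkContinuous
    { toFun := fun f => ⟨fun x => f (j x),
        Ell.mem_of_summable (f.hasSum_sq.summable.comp_injective hj)⟩
      map_add' := fun _ _ => rfl
      map_smul' := fun _ _ => rfl } 1 (by
    intro f
    rw [one_mul]
    refine (sq_le_sq₀ (norm_nonneg _) (norm_nonneg _)).1 ?_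
    rw [← (Ell.hasSum_sq _).tsum_eq, ← f.hasSum_sq.tsum_eq]
    exact (f.hasSum_sq.summable.comp_injective hj).tsum_le_tsum_of_inj j hj
      (fun _ _ => by positivity) (fun _ => le_rfl) f.hasSum_sq.summable)

/-- The operator `I ⊗ A` on the space with basis `Y ≃ R × X`, for an operator `A` on the space
with basis `X`: it acts by `A` on each slice through a point of `R`. -/
def ampl {X Y R : Type} (Φ : Y ≃ R × X) (A : Ell X →L[ℂ] Ell X) : Ell Y →L[ℂ] Ell Y :=
  let slice : R → Ell Y →L[ℂ] Ell X := fun r =>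
    restr (fun x => Φ.symm (r, x)) (fun a b h => by simpa using h)
  have key : ∀ f : Ell Y, Summable (fun y => ‖(A (slice (Φ y).1 f)) (Φ y).2‖ ^ 2) ∧
      ∑' y, ‖(A (slice (Φ y).1 f)) (Φ y).2‖ ^ 2 ≤ ‖A‖ ^ 2 * ‖f‖ ^ 2 := by
    intro f
    have h1 : HasSum (fun p : R × X => ‖f (Φ.symm p)‖ ^ 2) (‖f‖ ^ 2) :=
      (Equiv.hasSum_iff Φ.symm).2 f.hasSum_sq
    have h2 : HasSum (fun r => ‖slice r f‖ ^ 2) (‖f‖ ^ 2) :=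
      h1.prod_fiberwise (fun r => (slice r f).hasSum_sq)
    have h3 : ∀ r, ‖A (slice r f)‖ ^ 2 ≤ ‖A‖ ^ 2 * ‖slice r f‖ ^ 2 := fun r => by
      rw [← mul_pow]
      exact pow_le_pow_left₀ (norm_nonneg _) (A.le_opNorm _) 2
    have h4 : Summable (fun r => ‖A (slice r f)‖ ^ 2) :=
      (h2.summable.mul_left (‖A‖ ^ 2)).of_nonneg_of_le (fun _ => by positivity) h3
    have h5 : Summable (fun p : R × X => ‖(A (slice p.1 f)) p.2‖ ^ 2) := by
      rw [summable_prod_of_nonneg (fun _ => by positivity)]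
      refine ⟨fun r => (A (slice r f)).hasSum_sq.summable, ?_⟩
      simpa only [fun r => (A (slice r f)).hasSum_sq.tsum_eq] using h4
    refine ⟨(Equiv.summable_iff Φ).2 h5, ?_⟩
    rw [Equiv.tsum_eq Φ (fun p : R × X => ‖(A (slice p.1 f)) p.2‖ ^ 2), h5.tsum_prod]
    simp only [fun r => (A (slice r f)).hasSum_sq.tsum_eq]
    rw [← h2.tsum_eq, ← tsum_mul_left]
    exact h4.tsum_le_tsum h3 (h2.summable.mul_left _)
  LinearMap.mkContinuous
    { toFun := fun f => ⟨fun y => (A (slice (Φ y).1 f)) (Φ y).2, Ell.mem_of_summable (key f).1⟩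
      map_add' := fun f g => by
        ext y
        simp only [map_add]
        rfl
      map_smul' := fun c f => by
        ext y
        simp } ‖A‖ (by
    intro f
    refine (sq_le_sq₀ (norm_nonneg _) (by positivity)).1 ?_
    rw [← (Ell.hasSum_sq _).tsum_eq, mul_pow]
    exact (key f).2)

/-! ## Quantum registers and their state spaces -/

/-- The types of quantum variables. -/
inductive QType where
  | bool
  | int

/-- The labels of the computational basis of the state space of one variable. -/
def Val : QType → Type
  | .bool => Bool
  | .int => ℤ

/-- The label of the default basis vector `|0⟩`. -/
def Val.zero : (t : QType) → Val t
  | .bool => false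
  | .int => (0 : ℤ)

/-- A finite collection of quantum variables (registers), sorted by their types. -/
structure Ctx where
  Reg : QType → Type
  fin : ∀ t, Finite (Reg t)

/-- No variables. -/
def Ctx.empty : Ctx := ⟨fun _ => Empty, fun _ => inferInstance⟩

/-- Disjoint union of two collections of variables. -/
def Ctx.sum (Γ Δ : Ctx) : Ctx :=
  ⟨fun t => Γ.Reg t ⊕ Δ.Reg t, fun t => by
    have := Γ.fin t
    have := Δ.fin t
    infer_instance⟩

/-- A single variable, of type `t`. -/
def Ctx.single (t : QType) : Ctx := ⟨fun t' => PLift (t' = t), fun _ => inferInstance⟩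

/-- A type-preserving map of variables. -/
abbrev Hom (Γ Δ : Ctx) : Type := ∀ t, Γ.Reg t → Δ.Reg t

/-- A list of pairwise distinct variables of `Δ`, with positions (and types) given by `Γ`. -/
structure Emb (Γ Δ : Ctx) where
  toHom : Hom Γ Δ
  inj : ∀ t, Function.Injective (toHom t)

/-- Labels of the computational basis of the joint space of the variables in `Γ`. -/
abbrev State (Γ : Ctx) : Type := ∀ t, Γ.Reg t → Val t

/-- The basis label `0 ⋯ 0`. -/
def State.zero (Γ : Ctx) : State Γ := fun t _ => Val.zero t

/-- The Hilbert space `⨂ H_q` (tensor product over the variables `q` of `Γ`). -/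
abbrev Hil (Γ : Ctx) : Type := Ell (State Γ)

/-- Bounded operators. -/
abbrev Op (Γ : Ctx) : Type := Hil Γ →L[ℂ] Hil Γ

/-- The variables of `Δ` outside the list `e`. -/
def Emb.compl {Γ Δ : Ctx} (e : Emb Γ Δ) : Ctx :=
  ⟨fun t => {y : Δ.Reg t // y ∉ Set.range (e.toHom t)}, fun t => by
    have := Δ.fin t
    infer_instance⟩

/-- `H_Δ = H_rest ⊗ H_Γ` for a list `e` of variables of `Δ`, on the level of basis labels. -/
def Emb.split {Γ Δ : Ctx} (e : Emb Γ Δ) : State Δ ≃ State e.compl × State Γ := by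
  classical exact
  { toFun := fun s => (fun t y => s t y.1, fun t x => s t (e.toHom t x))
    invFun := fun p t y =>
      if h : ∃ x, e.toHom t x = y then p.2 t h.choose else p.1 t ⟨y, fun ⟨x, hx⟩ => h ⟨x, hx⟩⟩
    left_inv := fun s => by
      funext t y
      by_cases h : ∃ x, e.toHom t x = y
      · simp only [h, dite_true]
        rw [h.choose_spec]
      · simp only [h, dite_false]
    right_inv := fun p => by
      refine Prod.ext ?_ ?_
      · funext t y
        have h : ¬ ∃ x, e.toHom t x = y.1 := fun ⟨x, hx⟩ => y.2 ⟨x, hx⟩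
        exact dif_neg h
      · funext t x
        have h : ∃ x', e.toHom t x' = e.toHom t x := ⟨x, rfl⟩
        simp only [h, dite_true]
        rw [e.inj t h.choose_spec] }

/-- The operator `A` applied to the listed variables, tensored with the identity on the rest. -/
def lift {Γ Δ : Ctx} (e : Emb Γ Δ) (A : Op Γ) : Op Δ := ampl e.split A

/-- The one-element list consisting of `q`. -/
def Emb.ofReg {Γ : Ctx} {t : QType} (q : Γ.Reg t) : Emb (Ctx.single t) Γ :=
  ⟨fun _ h => h.down ▸ q, fun _ _ _ _ => Subsingleton.elim (α := PLift _) _ _⟩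

/-- `|0⟩_q ⟨i|`, tensored with the identity on the other variables. -/
def resetOp {Γ : Ctx} {t : QType} (q : Γ.Reg t) (i : State (Ctx.single t)) : Op Γ :=
  lift (Emb.ofReg q) (InnerProductSpace.rankOne ℂ (ket (State.zero _)) (ket i))

/-- The sum of a family of operators in the weak operator topology. -/
def wsum {ι : Type} {H K : Type} [NormedAddCommGroup H] [InnerProductSpace ℂ H]
    [NormedAddCommGroup K] [InnerProductSpace ℂ K] (A : ι → H →L[ℂ] K) : H →L[ℂ] K :=
  (∑' i, ContinuousLinearMapWOT.ofCLM (A i)).toCLM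

/-! ## Quantum operations and their duals -/

/-- The trace, in the computational basis. -/
def tr {Γ : Ctx} (A : Op Γ) : ℂ := ∑' s : State Γ, inner ℂ (ket s) (A (ket s))

/-- The trace class: the span of the positive operators with finite trace. -/
def TC (Γ : Ctx) : Submodule ℂ (Op Γ) :=
  Submodule.span ℂ
    {ρ : Op Γ | 0 ≤ ρ ∧ Summable fun s : State Γ => inner ℂ (ket s) (ρ (ket s))}

/-- Maps between operators; only their values on the trace class are relevant. -/
abbrev SOp (Γ Δ : Ctx) : Type := Op Γ → Op Δ

/-- A quantum operation: linear, completely positive and trace-non-increasing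
(on trace-class operators). -/
structure IsQOp {Γ Δ : Ctx} (E : SOp Γ Δ) : Prop where
  map_tc : ∀ ρ ∈ TC Γ, E ρ ∈ TC Δ
  map_add : ∀ ρ ∈ TC Γ, ∀ σ ∈ TC Γ, E (ρ + σ) = E ρ + E σ
  map_smul : ∀ (c : ℂ), ∀ ρ ∈ TC Γ, E (c • ρ) = c • E ρ
  cp : ∀ (n : ℕ) (T : Fin n → Fin n → Op Γ), (∀ i j, T i j ∈ TC Γ) →
    (∀ x : Fin n → Hil Γ, 0 ≤ ∑ i, ∑ j, inner ℂ (x i) (T i j (x j))) →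
    ∀ y : Fin n → Hil Δ, 0 ≤ ∑ i, ∑ j, inner ℂ (y i) (E (T i j) (y j))
  tni : ∀ ρ ∈ TC Γ, 0 ≤ ρ → (tr (E ρ)).re ≤ (tr ρ).re

/-- The Schrödinger–Heisenberg dual: `E* (A)` is the operator with
`tr (A E(ρ)) = tr (E*(A) ρ)` for all `ρ`. -/
def dual {Γ Δ : Ctx} (E : SOp Γ Δ) (A : Op Δ) : Op Γ :=
  Classical.epsilon fun B : Op Γ => ∀ ρ ∈ TC Γ, tr (A * E ρ) = tr (B * ρ)

/-- `E` is the least upper bound of the sequence `F`: a quantum operation with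
`E(ρ) = ⊔ₙ Fₙ(ρ)` in the Löwner order, for all states `ρ`. -/
def IsSup {Γ Δ : Ctx} (F : ℕ → SOp Γ Δ) (E : SOp Γ Δ) : Prop :=
  IsQOp E ∧ ∀ ρ ∈ TC Γ, 0 ≤ ρ → IsLUB (Set.range fun n => F n ρ) (E ρ)

/-- The least upper bound `⊔ₙ Fₙ`. -/
def sup {Γ Δ : Ctx} (F : ℕ → SOp Γ Δ) : SOp Γ Δ := Classical.epsilon (IsSup F)

/-! ## Recursive quantum programs with local variables and pointer passing -/

/-- The variables in scope when local variables `Δ` are added to globals `G` and locals `Γ`. -/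
def weaken (G Γ Δ : Ctx) : Emb (G.sum Γ) (G.sum (Γ.sum Δ)) :=
  ⟨fun _ => Sum.map id Sum.inl,
    fun _ => Function.Injective.sumMap Function.injective_id Sum.inl_injective⟩

/-- Extension of a basis label by a label `d` of the new local variables. -/
def State.extend {G Γ Δ : Ctx} (d : State Δ) (s : State (G.sum Γ)) :
    State (G.sum (Γ.sum Δ)) :=
  fun t => Sum.elim (fun x => s t (Sum.inl x)) (Sum.elim (fun x => s t (Sum.inr x)) (d t))

theorem State.extend_injective {G Γ Δ : Ctx} (d : State Δ) :
    Function.Injective (State.extend (G := G) (Γ := Γ) d) := by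
  intro s s' h
  funext t x
  rcases x with x | x
  · exact congrFun (congrFun h t) (Sum.inl x)
  · exact congrFun (congrFun h t) (Sum.inr (Sum.inl x))

/-- `⟨d|_Δ`, tensored with the identity on the other variables. -/
def bra {G Γ Δ : Ctx} (d : State Δ) : Hil (G.sum (Γ.sum Δ)) →L[ℂ] Hil (G.sum Γ) :=
  restr (State.extend d) (State.extend_injective d)

/-- `|d⟩_Δ`, tensored with the identity on the other variables. -/
def addKet {G Γ Δ : Ctx} (d : State Δ) : Hil (G.sum Γ) →L[ℂ] Hil (G.sum (Γ.sum Δ)) :=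
  ContinuousLinearMap.adjoint (bra d)

/-- Statements over global variables `G` and the formal parameters or local variables `Γ`
in scope, in which the procedures `j : π` with formal parameters `Y j` may be called.
Local variables are nameless: the block that declares them extends the scope, so that a choice of
fresh names and the replacement of the declared names by them are built in. -/
inductive Stmt (G : Ctx) {π : Type} (Y : π → Ctx) : Ctx → Type 1
  /-- the program that never terminates -/
  | bot {Γ : Ctx} : Stmt G Y Γ
  | skip {Γ : Ctx} : Stmt G Y Γ
  /-- initialization `q := |0⟩` -/
  | reset {Γ : Ctx} {t : QType} (q : (G.sum Γ).Reg t) : Stmt G Y Γ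
  /-- unitary operation `q̄ *= U` -/
  | apply {Γ : Ctx} (τ : Ctx) (q : Emb τ (G.sum Γ)) (U : Op τ) (hU : U ∈ unitary (Op τ)) :
      Stmt G Y Γ
  /-- sequential composition -/
  | seq {Γ : Ctx} (S₁ S₂ : Stmt G Y Γ) : Stmt G Y Γ
  /-- branching on the outcome `m : ι` of the measurement `M` of `q̄` -/
  | measure {Γ : Ctx} (τ : Ctx) (q : Emb τ (G.sum Γ)) (ι : Type) (M : ι → Op τ)
      (hM : HasSum (fun m => ContinuousLinearMapWOT.ofCLM (star (M m) * M m))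
        (ContinuousLinearMapWOT.ofCLM 1))
      (S : ι → Stmt G Y Γ) : Stmt G Y Γ
  /-- a block with local variables `Δ`, initialized to `|0⟩` and released at the end -/
  | block {Γ : Ctx} (Δ : Ctx) (S : Stmt G Y (Γ.sum Δ)) : Stmt G Y Γ
  /-- the call of procedure `j` with the actual parameters `a` -/
  | call {Γ : Ctx} (j : π) (a : Hom (Y j) (G.sum Γ)) : Stmt G Y Γ

/-- Parameter substitution on variables: globals are kept. -/
def substReg {G Γ Γ' : Ctx} (a : Hom Γ (G.sum Γ')) : Hom (G.sum Γ) (G.sum Γ') :=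
  fun t => Sum.elim Sum.inl (a t)

/-- Parameter substitution under a declaration of local variables `Δ`. -/
def substUnder {G Γ Γ' : Ctx} (a : Hom Γ (G.sum Γ')) (Δ : Ctx) :
    Hom (Γ.sum Δ) (G.sum (Γ'.sum Δ)) :=
  fun t => Sum.elim (fun x => (weaken G Γ' Δ).toHom t (a t x)) (fun x => Sum.inr (Sum.inr x))

/-- The substitution `S[a/y]` of actual for formal parameters. A unitary operation or measurement
whose list of variables is no longer repetition-free (because of aliased parameters) is not a
legitimate statement; its execution fails, that is, it becomes `bot`. -/
def Stmt.subst {G : Ctx} {π : Type} {Y : π → Ctx} {Γ : Ctx} (S : Stmt G Y Γ) :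
    {Γ' : Ctx} → Hom Γ (G.sum Γ') → Stmt G Y Γ' := by
  classical exact
  match S with
  | .bot => fun _ => .bot
  | .skip => fun _ => .skip
  | .reset q => fun a => .reset (substReg a _ q)
  | .apply τ q U hU => fun a =>
      if h : ∀ t, Function.Injective fun x => substReg a t (q.toHom t x)
      then .apply τ ⟨_, h⟩ U hU else .bot
  | .seq S₁ S₂ => fun a => .seq (S₁.subst a) (S₂.subst a)
  | .measure τ q ι M hM S => fun a =>
      if h : ∀ t, Function.Injective fun x => substReg a t (q.toHom t x)
      then .measure τ ⟨_, h⟩ ι M hM (fun m => (S m).subst a) else .bot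
  | .block Δ S => fun a => .block Δ (S.subst (substUnder a Δ))
  | .call j b => fun a => .call j (fun t x => substReg a t (b t x))

/-- The empty declaration of procedures. -/
def noProc : Empty → Ctx := fun j => j.elim

/-- Simultaneous replacement of every `call j p` by `skip; (T j)[p/y]`, giving a call-free
statement. -/
def Stmt.unfold {G : Ctx} {π : Type} {Y : π → Ctx} (T : ∀ j, Stmt G noProc (Y j)) :
    {Γ : Ctx} → Stmt G Y Γ → Stmt G noProc Γ
  | _, .bot => .bot
  | _, .skip => .skip
  | _, .reset q => .reset q
  | _, .apply τ q U hU => .apply τ q U hU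
  | _, .seq S₁ S₂ => .seq (S₁.unfold T) (S₂.unfold T)
  | _, .measure τ q ι M hM S => .measure τ q ι M hM (fun m => (S m).unfold T)
  | _, .block Δ S => .block Δ (S.unfold T)
  | _, .call j p => .seq .skip ((T j).subst p)

/-- The syntactic approximations of the procedure bodies `D`. -/
def approx {G : Ctx} {π : Type} {Y : π → Ctx} (D : ∀ j, Stmt G Y (Y j)) :
    ℕ → ∀ j, Stmt G noProc (Y j)
  | 0, _ => .bot
  | k + 1, j => (D j).unfold (approx D k)

/-! ## Denotational semantics -/

/-- The denotation of a statement, for a given denotation `c` of the calls. -/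
def denWith {G : Ctx} {π : Type} {Y : π → Ctx}
    (c : ∀ (Γ : Ctx) (j : π), Hom (Y j) (G.sum Γ) → SOp (G.sum Γ) (G.sum Γ)) :
    {Γ : Ctx} → Stmt G Y Γ → SOp (G.sum Γ) (G.sum Γ)
  | _, .bot => fun _ => 0
  | _, .skip => fun ρ => ρ
  | _, .reset q => fun ρ => wsum fun i => resetOp q i * ρ * star (resetOp q i)
  | _, .apply _ q U _ => fun ρ => lift q U * ρ * star (lift q U)
  | _, .seq S₁ S₂ => fun ρ => denWith c S₂ (denWith c S₁ ρ)
  | _, .measure _ q _ M _ S => fun ρ =>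
      wsum fun m => denWith c (S m) (lift q (M m) * ρ * star (lift q (M m)))
  | _, .block Δ S => fun ρ =>
      wsum fun d : State Δ =>
        bra d ∘L denWith c S (addKet (State.zero Δ) ∘L ρ ∘L bra (State.zero Δ)) ∘L addKet d
  | Γ, .call j a => c Γ j a

/-- The denotation of a call-free statement. -/
def den₀ {G Γ : Ctx} (S : Stmt G noProc Γ) : SOp (G.sum Γ) (G.sum Γ) :=
  denWith (fun _ j => j.elim) S

/-- The denotation `⟦S⟧` of a statement in the presence of the procedure declaration `D`; a call
is the least upper bound of its approximations. -/
def den {G : Ctx} {π : Type} {Y : π → Ctx} (D : ∀ j, Stmt G Y (Y j)) {Γ : Ctx}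
    (S : Stmt G Y Γ) : SOp (G.sum Γ) (G.sum Γ) :=
  denWith (fun _ j a => sup fun n => den₀ ((approx D n j).subst a)) S

/-! ## Parameterized quantum predicate terms -/

/-- Quantum predicates. -/
abbrev QPred (Γ : Ctx) : Type := {M : Op Γ // 0 ≤ M ∧ M ≤ 1}

/-- A quantum predicate variable: the collection of variables on which it ranges over quantum
predicates, and its name. -/
abbrev PVar : Type 1 := Ctx × ℕ

/-- Assignments of quantum predicates to quantum predicate variables. -/
abbrev Assign : Type 1 := ∀ X : PVar, QPred X.1

/-- The variables of `Q` are partitioned into the lists `r` and `s`. -/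
def IsPartition {R S Q : Ctx} (r : Emb R Q) (s : Emb S Q) : Prop :=
  ∀ t, Function.Bijective (Sum.elim (r.toHom t) (s.toHom t))

/-- Parameterized bases, indexed by their sets of parameters and their variables. -/
inductive Base : Set PVar → Ctx → Type 1
  /-- `X` -/
  | var {Q : Ctx} (x : ℕ) : Base {(Q, x)} Q
  /-- `I ⊗ B` -/
  | idTensor {p : Set PVar} {R S Q : Ctx} (r : Emb R Q) (s : Emb S Q) (h : IsPartition r s)
      (B : Base p S) : Base p Q
  /-- `B ⊗ I` -/
  | tensorId {p : Set PVar} {R S Q : Ctx} (r : Emb R Q) (s : Emb S Q) (h : IsPartition r s)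
      (B : Base p R) : Base p Q
  /-- `B ⊗ B'` -/
  | tensor {p p' : Set PVar} {R S Q : Ctx} (r : Emb R Q) (s : Emb S Q) (h : IsPartition r s)
      (hp : Disjoint p p') (B : Base p R) (B' : Base p' S) : Base (p ∪ p') Q

/-- The denotation of a base under an assignment. -/
def Base.den (v : Assign) : {p : Set PVar} → {Q : Ctx} → Base p Q → Op Q
  | _, Q, .var x => (v (Q, x)).1
  | _, _, .idTensor _ s _ B => lift s (B.den v)
  | _, _, .tensorId r _ _ B => lift r (B.den v)
  | _, _, .tensor r s _ _ B B' => lift r (B.den v) * lift s (B'.den v)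

/-- Parameterized quantum predicate terms `E*(B) + F*(I)` on `Γ` with base `B`, where `E + F` is
trace-non-increasing. The base may live on a collection `Q` of variables other than `Γ`; the case
`Q = Γ` is the usual one. -/
structure PQPT {p : Set PVar} {Q : Ctx} (B : Base p Q) (Γ : Ctx) where
  E : SOp Γ Q
  F : SOp Γ Q
  hE : IsQOp E
  hF : IsQOp F
  tni : ∀ ρ ∈ TC Γ, 0 ≤ ρ → (tr (E ρ)).re + (tr (F ρ)).re ≤ (tr ρ).re

/-- The denotation of a term under an assignment. -/
def PQPT.den {p : Set PVar} {Q : Ctx} {B : Base p Q} {Γ : Ctx} (P : PQPT B Γ) (v : Assign) :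
    Op Γ :=
  dual P.E (B.den v) + dual P.F 1

theorem tr_zero {Γ : Ctx} : tr (0 : Op Γ) = 0 := by simp [tr]

theorem re_tr_nonneg {Γ : Ctx} {ρ : Op Γ} (h : 0 ≤ ρ) : 0 ≤ (tr ρ).re := by
  rw [ContinuousLinearMap.nonneg_iff_isPositive] at h
  exact (Complex.nonneg_iff.1 (tsum_nonneg fun s => h.inner_nonneg_right (ket s))).1

theorem isQOp_zero {Γ Δ : Ctx} : IsQOp (fun _ : Op Γ => (0 : Op Δ)) where
  map_tc _ _ := Submodule.zero_mem _
  map_add _ _ _ _ := by simp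
  map_smul _ _ _ := by simp
  cp _ _ _ _ _ := by simp
  tni ρ _ h := by simpa [tr_zero] using re_tr_nonneg h

instance {p : Set PVar} {Q : Ctx} {B : Base p Q} {Γ : Ctx} : Nonempty (PQPT B Γ) :=
  ⟨⟨fun _ => 0, fun _ => 0, isQOp_zero, isQOp_zero, fun ρ _ h => by
    simpa [tr_zero] using re_tr_nonneg h⟩⟩

/-- The term with base `B` that denotes `φ v` under every assignment `v`. -/
def PQPT.mk' {p : Set PVar} {Q : Ctx} {B : Base p Q} {Γ : Ctx} (φ : Assign → Op Γ) : PQPT B Γ :=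
  Classical.epsilon fun R : PQPT B Γ => ∀ v, R.den v = φ v

/-- The terms `0` and `I`. -/
instance {p : Set PVar} {Q : Ctx} {B : Base p Q} {Γ : Ctx} : Zero (PQPT B Γ) :=
  ⟨PQPT.mk' fun _ => 0⟩

instance {p : Set PVar} {Q : Ctx} {B : Base p Q} {Γ : Ctx} : One (PQPT B Γ) :=
  ⟨PQPT.mk' fun _ => 1⟩

/-- `R` is the upper limit of the sequence `P`: for some term `P'` and some non-decreasing sequence
of quantum operations `Eₙ` with least upper bound `E'`, the term `Pₙ` is `Eₙ*(P')` and `R` is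
`E'*(P')`. -/
def IsUpperLimit {p : Set PVar} {Q : Ctx} {B : Base p Q} {Γ : Ctx} (P : ℕ → PQPT B Γ)
    (R : PQPT B Γ) : Prop :=
  ∃ (P' : PQPT B Γ) (E : ℕ → SOp Γ Γ) (E' : SOp Γ Γ),
    (∀ n, IsQOp (E n)) ∧ (∀ n, ∀ ρ ∈ TC Γ, 0 ≤ ρ → E n ρ ≤ E (n + 1) ρ) ∧ IsSup E E' ∧
    (∀ n v, (P n).den v = dual (E n) (P'.den v)) ∧ ∀ v, R.den v = dual E' (P'.den v)

/-- `R` is the lower limit of the sequence `P`: for some term `P'` and some non-decreasing sequence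
of quantum operations `Eₙ` with least upper bound `E'`, the term `Pₙ` is
`Eₙ*(P') + (I - Eₙ*(I))` and `R` is `E'*(P') + (I - E'*(I))`. -/
def IsLowerLimit {p : Set PVar} {Q : Ctx} {B : Base p Q} {Γ : Ctx} (P : ℕ → PQPT B Γ)
    (R : PQPT B Γ) : Prop :=
  ∃ (P' : PQPT B Γ) (E : ℕ → SOp Γ Γ) (E' : SOp Γ Γ),
    (∀ n, IsQOp (E n)) ∧ (∀ n, ∀ ρ ∈ TC Γ, 0 ≤ ρ → E n ρ ≤ E (n + 1) ρ) ∧ IsSup E E' ∧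
    (∀ n v, (P n).den v = dual (E n) (P'.den v) + (1 - dual (E n) 1)) ∧
    ∀ v, R.den v = dual E' (P'.den v) + (1 - dual E' 1)

/-- The upper limit `⊔ₙ Pₙ`. -/
def upperLimit {p : Set PVar} {Q : Ctx} {B : Base p Q} {Γ : Ctx} (P : ℕ → PQPT B Γ) :
    PQPT B Γ :=
  Classical.epsilon (IsUpperLimit P)

/-- The lower limit `⊓ₙ Pₙ`. -/
def lowerLimit {p : Set PVar} {Q : Ctx} {B : Base p Q} {Γ : Ctx} (P : ℕ → PQPT B Γ) :
    PQPT B Γ :=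
  Classical.epsilon (IsLowerLimit P)

/-! ## Formal weakest (liberal) preconditions -/

/-- The common clauses of the formal weakest and weakest liberal preconditions, for a given
precondition `b` of `bot` and given preconditions `c` of the calls. -/
def fxpWith {p : Set PVar} {Q : Ctx} {B : Base p Q} {G : Ctx} {π : Type} {Y : π → Ctx}
    (b : ∀ Γ : Ctx, PQPT B (G.sum Γ))
    (c : ∀ (Γ : Ctx) (j : π), Hom (Y j) (G.sum Γ) → PQPT B (G.sum Γ) → PQPT B (G.sum Γ)) :
    {Γ : Ctx} → Stmt G Y Γ → PQPT B (G.sum Γ) → PQPT B (G.sum Γ)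
  | Γ, .bot => fun _ => b Γ
  | _, .skip => fun P => P
  | _, .reset q => fun P =>
      .mk' fun v => wsum fun i => star (resetOp q i) * P.den v * resetOp q i
  | _, .apply _ q U _ => fun P => .mk' fun v => star (lift q U) * P.den v * lift q U
  | _, .seq S₁ S₂ => fun P => fxpWith b c S₁ (fxpWith b c S₂ P)
  | _, .measure _ q _ M _ S => fun P =>
      .mk' fun v =>
        wsum fun m => star (lift q (M m)) * (fxpWith b c (S m) P).den v * lift q (M m)
  | Γ, .block Δ S => fun P =>
      .mk' fun v => bra (State.zero Δ) ∘L
        (fxpWith b c S (.mk' fun v' => lift (weaken G Γ Δ) (P.den v'))).den v ∘L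
        addKet (State.zero Δ)
  | Γ, .call j a => fun P => c Γ j a P

/-- The formal weakest precondition for call-free statements. -/
def fwp₀ {p : Set PVar} {Q : Ctx} {B : Base p Q} {G Γ : Ctx} (S : Stmt G noProc Γ)
    (P : PQPT B (G.sum Γ)) : PQPT B (G.sum Γ) :=
  fxpWith (fun _ => 0) (fun _ j => j.elim) S P

/-- The formal weakest liberal precondition for call-free statements. -/
def fwlp₀ {p : Set PVar} {Q : Ctx} {B : Base p Q} {G Γ : Ctx} (S : Stmt G noProc Γ)
    (P : PQPT B (G.sum Γ)) : PQPT B (G.sum Γ) :=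
  fxpWith (fun _ => 1) (fun _ j => j.elim) S P

/-- The formal weakest precondition `fwp.S.P`. -/
def fwp {p : Set PVar} {Q : Ctx} {B : Base p Q} {G : Ctx} {π : Type} {Y : π → Ctx}
    (D : ∀ j, Stmt G Y (Y j)) {Γ : Ctx} (S : Stmt G Y Γ) (P : PQPT B (G.sum Γ)) :
    PQPT B (G.sum Γ) :=
  fxpWith (fun _ => 0)
    (fun _ j a P => upperLimit fun n => fwp₀ ((approx D n j).subst a) P) S P

/-- The formal weakest liberal precondition `fwlp.S.P`. -/
def fwlp {p : Set PVar} {Q : Ctx} {B : Base p Q} {G : Ctx} {π : Type} {Y : π → Ctx}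
    (D : ∀ j, Stmt G Y (Y j)) {Γ : Ctx} (S : Stmt G Y Γ) (P : PQPT B (G.sum Γ)) :
    PQPT B (G.sum Γ) :=
  fxpWith (fun _ => 1)
    (fun _ j a P => lowerLimit fun n => fwlp₀ ((approx D n j).subst a) P) S P

end

end QHL

open QHL

namespace QHL

open Filter Topology InnerProductSpace

/-! ## Hilbert–Schmidt operators and the trace class -/

section HilbertSchmidt

variable {X Y Z : Type}

@[simp]
theorem inner_ket_left (x : X) (f : Ell X) : inner ℂ (ket x) f = f x := by
  classical
  rw [ket]
  have := lp.inner_single_left (𝕜 := ℂ) (G := fun _ : X => ℂ) x 1 f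
  simpa using this

@[simp]
theorem inner_ket_right (x : X) (f : Ell X) : inner ℂ f (ket x) = starRingEnd ℂ (f x) := by
  rw [← inner_conj_symm, inner_ket_left]

theorem hasSum_inner_coord (f g : Ell X) :
    HasSum (fun x => starRingEnd ℂ (f x) * g x) (inner ℂ f g) := by
  have h := lp.hasSum_inner (𝕜 := ℂ) (G := fun _ : X => ℂ) f g
  simpa [RCLike.inner_apply, mul_comm] using h

theorem nonneg_iff_inner {H : Type} [NormedAddCommGroup H] [InnerProductSpace ℂ H]
    {T : H →L[ℂ] H} : 0 ≤ T ↔ ∀ x, 0 ≤ inner ℂ x (T x) := by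
  rw [ContinuousLinearMap.nonneg_iff_isPositive]
  refine ⟨fun h x => h.inner_nonneg_right x, fun h => ?_⟩
  rw [ContinuousLinearMap.isPositive_iff_complex]
  intro x
  have h' := h x
  rw [Complex.nonneg_iff] at h'
  rw [← inner_conj_symm, RCLike.conj_re]
  refine ⟨?_, h'.1⟩
  apply Complex.ext
  · simp only [Complex.ofReal_re, Complex.conj_re]
    rfl
  · simp only [Complex.ofReal_im, Complex.conj_im, ← h'.2, neg_zero]

theorem le_iff_inner {H : Type} [NormedAddCommGroup H] [InnerProductSpace ℂ H]
    {S T : H →L[ℂ] H} : S ≤ T ↔ ∀ x, inner ℂ x (S x) ≤ inner ℂ x (T x) := by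
  have h : S ≤ T ↔ 0 ≤ T - S := by
    rw [ContinuousLinearMap.le_def, ContinuousLinearMap.nonneg_iff_isPositive]
  rw [h, nonneg_iff_inner]
  simp only [_root_.sub_apply, inner_sub_right, sub_nonneg]

theorem exists_adjoint_comp_self {H : Type} [NormedAddCommGroup H] [InnerProductSpace ℂ H]
    [CompleteSpace H] {T : H →L[ℂ] H} (h : 0 ≤ T) :
    ∃ r : H →L[ℂ] H, T = ContinuousLinearMap.adjoint r ∘L r :=
  CStarAlgebra.nonneg_iff_eq_star_mul_self.1 h

theorem ext_inner_right {H K : Type} [NormedAddCommGroup H] [InnerProductSpace ℂ H]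
    [NormedAddCommGroup K] [InnerProductSpace ℂ K]
    {S T : H →L[ℂ] K} (h : ∀ x y, inner ℂ x (S y) = inner ℂ x (T y)) : S = T := by
  ext1 y
  exact ext_inner_left ℂ fun x => h x y

/-- Hilbert–Schmidt operators. -/
def IsHS (T : Ell X →L[ℂ] Ell Y) : Prop := Summable fun x => ‖T (ket x)‖ ^ 2

theorem adjoint_ket_apply (T : Ell X →L[ℂ] Ell Y) (x : X) (y : Y) :
    (ContinuousLinearMap.adjoint T (ket y)) x = starRingEnd ℂ (T (ket x) y) := by
  rw [← inner_ket_left, ContinuousLinearMap.adjoint_inner_right, inner_ket_right]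

theorem IsHS.summable_prod {T : Ell X →L[ℂ] Ell Y} (h : IsHS T) :
    Summable fun p : X × Y => ‖T (ket p.1) p.2‖ ^ 2 := by
  rw [summable_prod_of_nonneg (fun _ => by positivity)]
  refine ⟨fun x => (T (ket x)).hasSum_sq.summable, ?_⟩
  simp only [fun x => (T (ket x)).hasSum_sq.tsum_eq]
  exact h

theorem IsHS.hasSum_adjoint {T : Ell X →L[ℂ] Ell Y} (h : IsHS T) :
    HasSum (fun y => ‖ContinuousLinearMap.adjoint T (ket y)‖ ^ 2)
      (∑' x, ‖T (ket x)‖ ^ 2) := by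
  have hs := h.summable_prod.hasSum
  have h1 := hs.prod_fiberwise fun x => (T (ket x)).hasSum_sq
  have h2 : HasSum (fun p : Y × X => ‖T (ket p.2) p.1‖ ^ 2) _ :=
    (Equiv.hasSum_iff (Equiv.prodComm Y X)).2 hs
  rw [← h1.tsum_eq] at h2
  refine h2.prod_fiberwise fun y => ?_
  have h3 := (ContinuousLinearMap.adjoint T (ket y)).hasSum_sq
  simpa only [adjoint_ket_apply, RCLike.norm_conj] using h3

theorem IsHS.adjoint {T : Ell X →L[ℂ] Ell Y} (h : IsHS T) :
    IsHS (ContinuousLinearMap.adjoint T) :=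
  h.hasSum_adjoint.summable

theorem IsHS.comp_left {T : Ell X →L[ℂ] Ell Y} (h : IsHS T) (A : Ell Y →L[ℂ] Ell Z) :
    IsHS (A ∘L T) := by
  refine (h.mul_left (‖A‖ ^ 2)).of_nonneg_of_le (fun _ => by positivity) fun x => ?_
  rw [← mul_pow]
  exact pow_le_pow_left₀ (norm_nonneg _) (A.le_opNorm _) 2

theorem IsHS.comp_right {T : Ell Y →L[ℂ] Ell Z} (h : IsHS T) (A : Ell X →L[ℂ] Ell Y) :
    IsHS (T ∘L A) := by
  have := (h.adjoint.comp_left (ContinuousLinearMap.adjoint A)).adjoint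
  simpa [ContinuousLinearMap.adjoint_comp] using this

theorem HasSum.swap {E : Type} [NormedAddCommGroup E] {f : X × Y → E} (hs : Summable f)
    {g : X → E} {h : Y → E} (hg : ∀ x, HasSum (fun y => f (x, y)) (g x))
    (hh : ∀ y, HasSum (fun x => f (x, y)) (h y)) : HasSum g (∑' y, h y) := by
  obtain ⟨c, hc⟩ := hs
  have h2 : HasSum (fun p : Y × X => f (p.2, p.1)) c :=
    (Equiv.hasSum_iff (Equiv.prodComm Y X)).2 hc
  have h3 : HasSum h c := h2.prod_fiberwise hh
  rw [h3.tsum_eq]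
  exact hc.prod_fiberwise hg

theorem hasSum_inner_hs {S T : Ell X →L[ℂ] Ell Y} (hS : IsHS S) (hT : IsHS T) :
    HasSum (fun x => (inner ℂ (S (ket x)) (T (ket x)) : ℂ))
      (∑' y, (inner ℂ (ContinuousLinearMap.adjoint T (ket y))
        (ContinuousLinearMap.adjoint S (ket y)) : ℂ)) := by
  have hs : Summable fun p : X × Y => starRingEnd ℂ (S (ket p.1) p.2) * T (ket p.1) p.2 := by
    refine Summable.of_norm_bounded ((hS.summable_prod.add hT.summable_prod).mul_left (1 / 2))
      fun p => ?_
    rw [norm_mul, RCLike.norm_conj]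
    linarith [sq_nonneg (‖S (ket p.1) p.2‖ - ‖T (ket p.1) p.2‖),
      sub_sq ‖S (ket p.1) p.2‖ ‖T (ket p.1) p.2‖]
  refine HasSum.swap hs (fun x => hasSum_inner_coord (S (ket x)) (T (ket x))) fun y => ?_
  have := hasSum_inner_coord (ContinuousLinearMap.adjoint T (ket y))
    (ContinuousLinearMap.adjoint S (ket y))
  simp only [adjoint_ket_apply, Complex.conj_conj] at this
  simpa only [mul_comm] using this

end HilbertSchmidt

section TraceClass

variable {Γ Δ : Ctx} {X : Type}

theorem TC.summable {ρ : Op Γ} (h : ρ ∈ TC Γ) :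
    Summable fun s : State Γ => inner ℂ (ket s) (ρ (ket s)) := by
  induction h using Submodule.span_induction with
  | mem ρ h => exact h.2
  | zero => simp
  | add a b _ _ ha hb =>
    refine (ha.add hb).congr fun s => ?_
    simp
  | smul c a _ ha =>
    refine (ha.mul_left c).congr fun s => ?_
    simp

theorem TC.exists_hs {ρ : Op Γ} (h : ρ ∈ TC Γ) (h0 : 0 ≤ ρ) :
    ∃ r : Op Γ, IsHS r ∧ ρ = ContinuousLinearMap.adjoint r ∘L r := by
  obtain ⟨r, hr⟩ := exists_adjoint_comp_self h0
  refine ⟨r, ?_, hr⟩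
  have h1 := Complex.reCLM.summable (TC.summable h)
  refine h1.congr fun s => ?_
  have h2 : inner ℂ (ket s) (ρ (ket s)) = ((‖r (ket s)‖ : ℂ)) ^ 2 := by
    rw [hr, ContinuousLinearMap.comp_apply,
      ContinuousLinearMap.adjoint_inner_right, inner_self_eq_norm_sq_to_K]
    rfl
  rw [h2, Complex.reCLM_apply, ← Complex.ofReal_pow, Complex.ofReal_re]

theorem adjoint_comp_self_nonneg (r : Hil Γ →L[ℂ] Ell X) : 0 ≤ ContinuousLinearMap.adjoint r ∘L r := by
  rw [nonneg_iff_inner]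
  intro x
  rw [ContinuousLinearMap.comp_apply, ContinuousLinearMap.adjoint_inner_right]
  rw [inner_self_eq_norm_sq_to_K]
  rw [← RCLike.ofReal_pow]
  exact Complex.zero_le_real.2 (sq_nonneg ‖r x‖)

theorem IsHS.hasSum_trace {r : Hil Γ →L[ℂ] Ell X} (h : IsHS r) (A : Op Γ) :
    HasSum (fun s => inner ℂ (ket s) (A (ContinuousLinearMap.adjoint r (r (ket s)))))
      (∑' y, inner ℂ (ContinuousLinearMap.adjoint r (ket y))
        (A (ContinuousLinearMap.adjoint r (ket y)))) := by
  have hS := h.comp_right (ContinuousLinearMap.adjoint A)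
  have := hasSum_inner_hs hS h
  simpa [ContinuousLinearMap.adjoint_comp, ContinuousLinearMap.adjoint_inner_left,
    ← ContinuousLinearMap.adjoint_inner_right] using this

theorem IsHS.mem_tc {r : Hil Γ →L[ℂ] Ell X} (h : IsHS r) :
    ContinuousLinearMap.adjoint r ∘L r ∈ TC Γ :=
  Submodule.subset_span ⟨adjoint_comp_self_nonneg r, (h.hasSum_trace 1).summable⟩

theorem IsHS.tr_mul {r : Hil Γ →L[ℂ] Ell X} (h : IsHS r) (A : Op Γ) :
    tr (A * (ContinuousLinearMap.adjoint r ∘L r)) =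
      ∑' y, inner ℂ (ContinuousLinearMap.adjoint r (ket y))
        (A (ContinuousLinearMap.adjoint r (ket y))) :=
  (h.hasSum_trace A).tsum_eq

/-- Every trace-class operator is a linear combination of positive ones. -/
theorem TC.induction {p : Op Γ → Prop} (pos : ∀ ρ ∈ TC Γ, 0 ≤ ρ → p ρ)
    (add : ∀ ρ ∈ TC Γ, ∀ σ ∈ TC Γ, p ρ → p σ → p (ρ + σ))
    (smul : ∀ (c : ℂ), ∀ ρ ∈ TC Γ, p ρ → p (c • ρ)) {ρ : Op Γ} (h : ρ ∈ TC Γ) : p ρ := by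
  induction h using Submodule.span_induction with
  | mem ρ h => exact pos ρ (Submodule.subset_span h) h.1
  | zero => exact pos 0 (Submodule.zero_mem _) le_rfl
  | add a b h1 h2 ha hb => exact add a h1 b h2 ha hb
  | smul c a h1 ha => exact smul c a h1 ha

theorem TC.summable_mul (A : Op Γ) {ρ : Op Γ} (h : ρ ∈ TC Γ) :
    Summable fun s : State Γ => inner ℂ (ket s) ((A * ρ) (ket s)) := by
  induction h using Submodule.span_induction with
  | mem ρ h =>
    obtain ⟨r, hr, rfl⟩ := TC.exists_hs (Submodule.subset_span h) h.1
    exact (hr.hasSum_trace A).summable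
  | zero => simp
  | add a b _ _ ha hb =>
    refine (ha.add hb).congr fun s => ?_
    simp
  | smul c a _ ha =>
    refine (ha.mul_left c).congr fun s => ?_
    simp

theorem tr_mul_add (A : Op Γ) {ρ σ : Op Γ} (h : ρ ∈ TC Γ) (h' : σ ∈ TC Γ) :
    tr (A * (ρ + σ)) = tr (A * ρ) + tr (A * σ) := by
  rw [tr, tr, tr, ← (TC.summable_mul A h).tsum_add (TC.summable_mul A h')]
  simp

theorem tr_add_mul (A B : Op Γ) {ρ : Op Γ} (h : ρ ∈ TC Γ) :
    tr ((A + B) * ρ) = tr (A * ρ) + tr (B * ρ) := by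
  rw [tr, tr, tr, ← (TC.summable_mul A h).tsum_add (TC.summable_mul B h)]
  simp

theorem tr_sub_mul (A B : Op Γ) {ρ : Op Γ} (h : ρ ∈ TC Γ) :
    tr ((A - B) * ρ) = tr (A * ρ) - tr (B * ρ) := by
  rw [tr, tr, tr, ← (TC.summable_mul A h).tsum_sub (TC.summable_mul B h)]
  simp

theorem tr_mul_smul (A : Op Γ) (c : ℂ) (ρ : Op Γ) : tr (A * c • ρ) = c * tr (A * ρ) := by
  rw [tr, tr, ← tsum_mul_left]
  simp

theorem tr_add {ρ σ : Op Γ} (h : ρ ∈ TC Γ) (h' : σ ∈ TC Γ) :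
    tr (ρ + σ) = tr ρ + tr σ := by
  simpa using tr_mul_add 1 h h'

theorem tr_smul (c : ℂ) (ρ : Op Γ) : tr (c • ρ) = c * tr ρ := by
  simpa using tr_mul_smul 1 c ρ

theorem tr_sub {ρ σ : Op Γ} (h : ρ ∈ TC Γ) (h' : σ ∈ TC Γ) :
    tr (ρ - σ) = tr ρ - tr σ := by
  rw [sub_eq_add_neg, tr_add h ((TC Γ).neg_mem h'), ← neg_one_smul ℂ σ, tr_smul]
  ring

theorem tr_im {ρ : Op Γ} (h : 0 ≤ ρ) : (tr ρ).im = 0 := by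
  rw [nonneg_iff_inner] at h
  exact (Complex.nonneg_iff.1 (tsum_nonneg fun s => h (ket s))).2.symm

theorem re_tr_mono {ρ σ : Op Γ} (h : ρ ∈ TC Γ) (h' : σ ∈ TC Γ) (hle : ρ ≤ σ) :
    (tr ρ).re ≤ (tr σ).re := by
  have := re_tr_nonneg (sub_nonneg.2 hle)
  rw [tr_sub h' h, Complex.sub_re] at this
  linarith

theorem IsHS.tr_eq {r : Hil Γ →L[ℂ] Ell X} (h : IsHS r) :
    tr (ContinuousLinearMap.adjoint r ∘L r) =
      ((∑' y, ‖ContinuousLinearMap.adjoint r (ket y)‖ ^ 2 : ℝ) : ℂ) := by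
  rw [← one_mul (_ ∘L _), h.tr_mul, Complex.ofReal_tsum]
  refine tsum_congr fun y => ?_
  rw [one_apply_eq_self, inner_self_eq_norm_sq_to_K]
  simp

theorem norm_tr_mul_le (A : Op Γ) {ρ : Op Γ} (h : ρ ∈ TC Γ) (h0 : 0 ≤ ρ) :
    ‖tr (A * ρ)‖ ≤ ‖A‖ * (tr ρ).re := by
  obtain ⟨r, hr, rfl⟩ := TC.exists_hs h h0
  rw [hr.tr_mul, hr.tr_eq, Complex.ofReal_re, ← tsum_mul_left]
  refine tsum_of_norm_bounded (hr.adjoint.mul_left _).hasSum fun y => ?_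
  refine (norm_inner_le_norm _ _).trans ?_
  calc _ ≤ ‖ContinuousLinearMap.adjoint r (ket y)‖ *
        (‖A‖ * ‖ContinuousLinearMap.adjoint r (ket y)‖) := by
        gcongr
        exact A.le_opNorm _
    _ = _ := by ring

theorem inner_le_tr {ρ : Op Γ} (h : ρ ∈ TC Γ) (h0 : 0 ≤ ρ) (x : Hil Γ) :
    (inner ℂ x (ρ x)).re ≤ (tr ρ).re * ‖x‖ ^ 2 := by
  obtain ⟨r, hr, rfl⟩ := TC.exists_hs h h0
  rw [hr.tr_eq, Complex.ofReal_re, ContinuousLinearMap.comp_apply,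
    ContinuousLinearMap.adjoint_inner_right,
    inner_self_eq_norm_sq_to_K]
  norm_cast
  rw [← (Ell.hasSum_sq (r x)).tsum_eq, ← tsum_mul_right]
  refine (Ell.hasSum_sq (r x)).summable.tsum_le_tsum (fun s => ?_)
    (hr.adjoint.mul_right _)
  rw [← inner_ket_left, ← ContinuousLinearMap.adjoint_inner_left, ← mul_pow]
  exact pow_le_pow_left₀ (norm_nonneg _) (norm_inner_le_norm _ _) 2

theorem rankOne_polarization (x y : Hil Γ) : rankOne ℂ x y = (1 / 4 : ℂ) •
    (rankOne ℂ (x + y) (x + y) + (-1 : ℂ) • rankOne ℂ (x - y) (x - y) +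
      Complex.I • rankOne ℂ (x + Complex.I • y) (x + Complex.I • y) +
      (-Complex.I) • rankOne ℂ (x - Complex.I • y) (x - Complex.I • y)) := by
  ext1 z
  simp only [_root_.add_apply, _root_.smul_apply, rankOne_apply,
    inner_add_left, inner_sub_left, inner_smul_left, Complex.conj_I]
  match_scalars
  · linear_combination (1 / 2) * inner ℂ y z * Complex.I_mul_I
  · linear_combination -(1 / 2) * inner ℂ x z * Complex.I_mul_I

theorem exists_hs_rankOne_self (x : Hil Γ) :
    ∃ r : Op Γ, IsHS r ∧ rankOne ℂ x x = ContinuousLinearMap.adjoint r ∘L r := by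
  classical
  let o : State Γ := State.zero Γ
  refine ⟨rankOne ℂ (ket o) x, ?_, ?_⟩
  · refine (x.hasSum_sq.summable.mul_right (‖ket o‖ ^ 2)).congr fun s => ?_
    rw [rankOne_apply, inner_ket_right, norm_smul, RCLike.norm_conj, mul_pow]
  · have : ‖(ket o : Hil Γ)‖ = 1 := by
      rw [ket]
      simp
    ext1 z
    simp [this]

theorem rankOne_self_mem (x : Hil Γ) : rankOne ℂ x x ∈ TC Γ := by
  obtain ⟨r, hr, h⟩ := exists_hs_rankOne_self x
  exact h ▸ hr.mem_tc

theorem rankOne_self_nonneg (x : Hil Γ) : 0 ≤ (rankOne ℂ x x : Op Γ) := by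
  obtain ⟨r, hr, h⟩ := exists_hs_rankOne_self x
  exact h ▸ adjoint_comp_self_nonneg r

theorem rankOne_mem (x y : Hil Γ) : rankOne ℂ x y ∈ TC Γ := by
  rw [rankOne_polarization]
  exact (TC Γ).smul_mem _ ((TC Γ).add_mem ((TC Γ).add_mem ((TC Γ).add_mem (rankOne_self_mem _)
    ((TC Γ).smul_mem _ (rankOne_self_mem _))) ((TC Γ).smul_mem _ (rankOne_self_mem _)))
    ((TC Γ).smul_mem _ (rankOne_self_mem _)))

theorem tr_mul_rankOne (A : Op Γ) (x y : Hil Γ) :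
    tr (A * rankOne ℂ x y) = inner ℂ y (A x) := by
  rw [tr, ← (hasSum_inner_coord y (A x)).tsum_eq]
  refine tsum_congr fun s => ?_
  simp

theorem tr_rankOne (x y : Hil Γ) : tr (rankOne ℂ x y : Op Γ) = inner ℂ y x := by
  simpa using tr_mul_rankOne 1 x y

theorem op_ext_tr {A B : Op Γ} (h : ∀ ρ ∈ TC Γ, tr (A * ρ) = tr (B * ρ)) : A = B := by
  refine ext_inner_right fun x y => ?_
  rw [← tr_mul_rankOne, ← tr_mul_rankOne]
  exact h _ (rankOne_mem y x)

end TraceClass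

/-! ## Bounded sesquilinear forms and weak limits of operators -/

section Forms

variable {H : Type} [NormedAddCommGroup H] [InnerProductSpace ℂ H]

/-- Forms that are conjugate-linear in the first and linear in the second argument. -/
structure IsSesq (f : H → H → ℂ) : Prop where
  add_left : ∀ x y z, f (x + y) z = f x z + f y z
  smul_left : ∀ (c : ℂ) x z, f (c • x) z = starRingEnd ℂ c * f x z
  add_right : ∀ x y z, f x (y + z) = f x y + f x z
  smul_right : ∀ (c : ℂ) x z, f x (c • z) = c * f x z

theorem isSesq_inner (T : H →L[ℂ] H) : IsSesq fun x y => inner ℂ x (T y) where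
  add_left x y z := inner_add_left _ _ _
  smul_left c x z := by rw [inner_smul_left]
  add_right x y z := by rw [map_add, inner_add_right]
  smul_right c x z := by rw [map_smul, inner_smul_right]

theorem IsSesq.polarization {f : H → H → ℂ} (hf : IsSesq f) (x y : H) :
    f x y = (1 / 4) * (f (x + y) (x + y) - f (x + (-1 : ℂ) • y) (x + (-1 : ℂ) • y)
      - Complex.I * f (x + Complex.I • y) (x + Complex.I • y)
      + Complex.I * f (x + (-Complex.I) • y) (x + (-Complex.I) • y)) := by
  simp only [hf.add_left, hf.add_right, hf.smul_left, hf.smul_right, map_neg, Complex.conj_I,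
    map_one]
  linear_combination ((1 / 2) * f x y - (1 / 2) * f y x) * Complex.I_mul_I

theorem IsSesq.norm_le {f : H → H → ℂ} (hf : IsSesq f) {C : ℝ}
    (hC : ∀ x, ‖f x x‖ ≤ C * ‖x‖ ^ 2) (hC0 : 0 ≤ C) (x y : H) :
    ‖f x y‖ ≤ 4 * C * ‖x‖ * ‖y‖ := by
  have key : ∀ x y : H, ‖x‖ ≤ 1 → ‖y‖ ≤ 1 → ‖f x y‖ ≤ 4 * C := by
    intro x y hx hy
    have h1 : ∀ c : ℂ, ‖c‖ = 1 → ‖f (x + c • y) (x + c • y)‖ ≤ 4 * C := by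
      intro c hc
      have h2 : ‖x + c • y‖ ≤ 2 := by
        refine (norm_add_le _ _).trans ?_
        rw [norm_smul, hc]
        linarith
      have h3 : ‖x + c • y‖ ^ 2 ≤ 2 ^ 2 := pow_le_pow_left₀ (norm_nonneg _) h2 2
      refine (hC _).trans ?_
      nlinarith
    have ha := h1 1 (by simp)
    have hb := h1 (-1) (by simp)
    have hc := h1 Complex.I (by simp)
    have hd := h1 (-Complex.I) (by simp)
    rw [one_smul] at ha
    rw [hf.polarization x y, norm_mul]
    have h4 := norm_add_le (f (x + y) (x + y) - f (x + (-1 : ℂ) • y) (x + (-1 : ℂ) • y)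
      - Complex.I * f (x + Complex.I • y) (x + Complex.I • y))
      (Complex.I * f (x + (-Complex.I) • y) (x + (-Complex.I) • y))
    have h5 := norm_sub_le (f (x + y) (x + y) - f (x + (-1 : ℂ) • y) (x + (-1 : ℂ) • y))
      (Complex.I * f (x + Complex.I • y) (x + Complex.I • y))
    have h6 := norm_sub_le (f (x + y) (x + y)) (f (x + (-1 : ℂ) • y) (x + (-1 : ℂ) • y))
    rw [norm_mul, Complex.norm_I, one_mul] at h4 h5
    have h7 : ‖(1 / 4 : ℂ)‖ = 1 / 4 := by simp
    rw [h7]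
    linarith
  have hscale : ∀ z : H, ∃ u : H, ‖u‖ ≤ 1 ∧ z = ((‖z‖ : ℝ) : ℂ) • u := by
    intro z
    by_cases hz : z = 0
    · exact ⟨0, by simp, by simp [hz]⟩
    · have hz' : ‖z‖ ≠ 0 := norm_ne_zero_iff.2 hz
      refine ⟨((‖z‖⁻¹ : ℝ) : ℂ) • z, ?_, ?_⟩
      · rw [norm_smul, Complex.norm_real, norm_inv, norm_norm, inv_mul_cancel₀ hz']
      · rw [smul_smul, ← Complex.ofReal_mul, mul_inv_cancel₀ hz', Complex.ofReal_one, one_smul]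
  obtain ⟨u, hu, hxu⟩ := hscale x
  obtain ⟨w, hw, hyw⟩ := hscale y
  have h8 : f x y = (‖x‖ : ℂ) * ((‖y‖ : ℂ) * f u w) := by
    conv_lhs => rw [hxu, hyw]
    rw [hf.smul_left, hf.smul_right, Complex.conj_ofReal]
  rw [h8, norm_mul, norm_mul, Complex.norm_real, Complex.norm_real, norm_norm, norm_norm]
  have := mul_le_mul_of_nonneg_left (key u w hu hw) (mul_nonneg (norm_nonneg x) (norm_nonneg y))
  linarith

theorem IsSesq.exists_op [CompleteSpace H] {f : H → H → ℂ} (hf : IsSesq f) {C : ℝ}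
    (hC : ∀ x, ‖f x x‖ ≤ C * ‖x‖ ^ 2) (hC0 : 0 ≤ C) :
    ∃ T : H →L[ℂ] H, ∀ x y, inner ℂ x (T y) = f x y := by
  let B : H →L⋆[ℂ] H →L[ℂ] ℂ := LinearMap.mkContinuous₂
    (LinearMap.mk₂'ₛₗ (starRingEnd ℂ) (RingHom.id ℂ) f hf.add_left hf.smul_left hf.add_right
      hf.smul_right) (4 * C) (hf.norm_le hC hC0)
  refine ⟨ContinuousLinearMap.adjoint (continuousLinearMapOfBilin B), fun x y => ?_⟩
  rw [ContinuousLinearMap.adjoint_inner_right, continuousLinearMapOfBilin_apply]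
  rfl

theorem tendsto_inner_of_quadratic {ι : Type} {l : Filter ι} {T : ι → H →L[ℂ] H}
    {T' : H →L[ℂ] H} (h : ∀ x, Tendsto (fun i => inner ℂ x (T i x)) l (𝓝 (inner ℂ x (T' x))))
    (x y : H) : Tendsto (fun i => inner ℂ x (T i y)) l (𝓝 (inner ℂ x (T' y))) := by
  rw [(isSesq_inner T').polarization x y]
  simp only [fun i => (isSesq_inner (T i)).polarization x y]
  exact ((((h _).sub (h _)).sub ((h _).const_mul _)).add ((h _).const_mul _)).const_mul _

theorem exists_weak_limit [CompleteSpace H] {ι : Type} {l : Filter ι} [l.NeBot]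
    {T : ι → H →L[ℂ] H} {C : ℝ} (hC0 : 0 ≤ C) (hb : ∀ i x, ‖inner ℂ x (T i x)‖ ≤ C * ‖x‖ ^ 2)
    (hc : ∀ x, ∃ c, Tendsto (fun i => inner ℂ x (T i x)) l (𝓝 c)) :
    ∃ T' : H →L[ℂ] H, ∀ x y, Tendsto (fun i => inner ℂ x (T i y)) l (𝓝 (inner ℂ x (T' y))) := by
  have h1 : ∀ x y, ∃ c, Tendsto (fun i => inner ℂ x (T i y)) l (𝓝 c) := by
    intro x y
    choose q hq using hc
    simp only [fun i => (isSesq_inner (T i)).polarization x y]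
    exact ⟨_, ((((hq _).sub (hq _)).sub ((hq _).const_mul _)).add
      ((hq _).const_mul _)).const_mul _⟩
  choose f hf using h1
  have hs : IsSesq f :=
    { add_left := fun x y z => tendsto_nhds_unique (hf (x + y) z) (by
        simpa only [inner_add_left] using (hf x z).add (hf y z))
      smul_left := fun c x z => tendsto_nhds_unique (hf (c • x) z) (by
        simpa only [inner_smul_left] using (hf x z).const_mul (starRingEnd ℂ c))
      add_right := fun x y z => tendsto_nhds_unique (hf x (y + z)) (by
        simpa only [map_add, inner_add_right] using (hf x y).add (hf x z))
      smul_right := fun c x z => tendsto_nhds_unique (hf x (c • z)) (by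
        simpa only [map_smul, inner_smul_right] using (hf x z).const_mul c) }
  obtain ⟨T', hT'⟩ := hs.exists_op
    (fun x => le_of_tendsto (hf x x).norm (Eventually.of_forall fun i => hb i x)) hC0
  exact ⟨T', fun x y => (hT' x y).symm ▸ hf x y⟩

end Forms

/-! ## Bounded functionals on the trace class -/

section Functionals

variable {Γ Δ : Ctx}

/-- Linear functionals on the trace class that are bounded by the trace on positive operators. -/
structure IsTraceBounded (φ : Op Γ → ℂ) (C : ℝ) : Prop where
  add : ∀ ρ ∈ TC Γ, ∀ σ ∈ TC Γ, φ (ρ + σ) = φ ρ + φ σ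
  smul : ∀ (c : ℂ), ∀ ρ ∈ TC Γ, φ (c • ρ) = c * φ ρ
  bound : ∀ ρ ∈ TC Γ, 0 ≤ ρ → ‖φ ρ‖ ≤ C * (tr ρ).re

theorem isTraceBounded_tr_mul (A : Op Γ) : IsTraceBounded (fun ρ => tr (A * ρ)) ‖A‖ where
  add _ h _ h' := tr_mul_add A h h'
  smul c ρ _ := tr_mul_smul A c ρ
  bound _ h h0 := norm_tr_mul_le A h h0

theorem IsTraceBounded.sub {φ : Op Γ → ℂ} {C : ℝ} (h : IsTraceBounded φ C) {ρ σ : Op Γ}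
    (hρ : ρ ∈ TC Γ) (hσ : σ ∈ TC Γ) : φ (ρ - σ) = φ ρ - φ σ := by
  have h1 := h.smul (-1) σ hσ
  have h2 := h.add ρ hρ _ ((TC Γ).smul_mem (-1) hσ)
  rw [neg_one_smul, ← sub_eq_add_neg, ← neg_one_smul ℂ σ, h1] at h2
  rw [h2]
  ring

theorem IsTraceBounded.tendsto {φ : Op Γ → ℂ} {C : ℝ} (h : IsTraceBounded φ C) {ι : Type}
    {l : Filter ι} {σ : ι → Op Γ} {ρ : Op Γ} (hρ : ρ ∈ TC Γ) (hσ : ∀ i, σ i ∈ TC Γ)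
    (hle : ∀ i, σ i ≤ ρ) (ht : Tendsto (fun i => (tr (σ i)).re) l (𝓝 (tr ρ).re)) :
    Tendsto (fun i => φ (σ i)) l (𝓝 (φ ρ)) := by
  rw [tendsto_iff_norm_sub_tendsto_zero]
  have h1 : Tendsto (fun i => C * ((tr ρ).re - (tr (σ i)).re)) l (𝓝 0) := by
    have := (tendsto_const_nhds (x := (tr ρ).re)).sub ht
    simpa using this.const_mul C
  refine squeeze_zero (fun _ => norm_nonneg _) (fun i => ?_) h1
  have h2 := h.bound _ ((TC Γ).sub_mem hρ (hσ i)) (sub_nonneg.2 (hle i))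
  rwa [h.sub hρ (hσ i), tr_sub hρ (hσ i), Complex.sub_re, norm_sub_rev] at h2

/-- The approximation of `r† r` by operators of finite rank. -/
noncomputable def finiteRank (r : Op Γ) (F : Finset (State Γ)) : Op Γ :=
  ∑ s ∈ F, rankOne ℂ (ContinuousLinearMap.adjoint r (ket s)) (ContinuousLinearMap.adjoint r (ket s))

theorem finiteRank_insert [DecidableEq (State Γ)] (r : Op Γ) {a : State Γ} {F : Finset (State Γ)}
    (ha : a ∉ F) : finiteRank r (insert a F) = rankOne ℂ (ContinuousLinearMap.adjoint r (ket a))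
      (ContinuousLinearMap.adjoint r (ket a)) + finiteRank r F :=
  Finset.sum_insert ha

theorem finiteRank_mem (r : Op Γ) (F : Finset (State Γ)) : finiteRank r F ∈ TC Γ :=
  (TC Γ).sum_mem fun _ _ => rankOne_self_mem _

theorem finiteRank_le (r : Op Γ) (F : Finset (State Γ)) :
    finiteRank r F ≤ ContinuousLinearMap.adjoint r ∘L r := by
  rw [le_iff_inner]
  intro x
  have h1 : inner ℂ x (finiteRank r F x) = ((∑ s ∈ F, ‖r x s‖ ^ 2 : ℝ) : ℂ) := by
    rw [finiteRank, _root_.sum_apply, inner_sum, Complex.ofReal_sum]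
    refine Finset.sum_congr rfl fun s _ => ?_
    rw [rankOne_apply, inner_smul_right, ContinuousLinearMap.adjoint_inner_left,
      ContinuousLinearMap.adjoint_inner_right, inner_ket_left, inner_ket_right, Complex.mul_conj']
    simp
  have h2 : inner ℂ x ((ContinuousLinearMap.adjoint r ∘L r) x) = ((‖r x‖ ^ 2 : ℝ) : ℂ) := by
    rw [ContinuousLinearMap.comp_apply, ContinuousLinearMap.adjoint_inner_right,
      inner_self_eq_norm_sq_to_K]
    simp
  rw [h1, h2, Complex.real_le_real]
  exact sum_le_hasSum F (fun _ _ => by positivity) (r x).hasSum_sq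

theorem tr_finiteRank (r : Op Γ) (F : Finset (State Γ)) :
    (tr (finiteRank r F)).re = ∑ s ∈ F, ‖ContinuousLinearMap.adjoint r (ket s)‖ ^ 2 := by
  classical
  induction F using Finset.induction_on with
  | empty => simp [finiteRank, tr_zero]
  | insert a F ha ih =>
    rw [Finset.sum_insert ha, ← ih, finiteRank_insert r ha,
      tr_add (rankOne_self_mem _) (finiteRank_mem r F), tr_rankOne, Complex.add_re,
      inner_self_eq_norm_sq_to_K, ← RCLike.ofReal_pow]
    rfl

theorem IsTraceBounded.tendsto_finiteRank {φ : Op Γ → ℂ} {C : ℝ} (h : IsTraceBounded φ C)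
    {r : Op Γ} (hr : IsHS r) :
    Tendsto (fun F => φ (finiteRank r F)) atTop (𝓝 (φ (ContinuousLinearMap.adjoint r ∘L r))) := by
  refine h.tendsto hr.mem_tc (finiteRank_mem r) (finiteRank_le r) ?_
  simp only [tr_finiteRank]
  rw [hr.tr_eq, Complex.ofReal_re]
  exact hr.adjoint.hasSum

theorem IsTraceBounded.eq_of_rankOne {φ ψ : Op Γ → ℂ} {C C' : ℝ} (hφ : IsTraceBounded φ C)
    (hψ : IsTraceBounded ψ C') (h : ∀ x, φ (rankOne ℂ x x) = ψ (rankOne ℂ x x)) {ρ : Op Γ}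
    (hρ : ρ ∈ TC Γ) : φ ρ = ψ ρ := by
  induction hρ using Submodule.span_induction with
  | mem ρ hρ =>
    obtain ⟨r, hr, rfl⟩ := TC.exists_hs (Submodule.subset_span hρ) hρ.1
    refine tendsto_nhds_unique (hφ.tendsto_finiteRank hr)
      ((hψ.tendsto_finiteRank hr).congr fun F => ?_)
    classical
    induction F using Finset.induction_on with
    | empty =>
      have h1 := hφ.smul 0 0 (Submodule.zero_mem _)
      have h2 := hψ.smul 0 0 (Submodule.zero_mem _)
      simp only [smul_zero, zero_mul] at h1 h2
      simp [finiteRank, h1, h2]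
    | insert a F ha ih =>
      rw [finiteRank_insert r ha, hφ.add _ (rankOne_self_mem _) _ (finiteRank_mem r F),
        hψ.add _ (rankOne_self_mem _) _ (finiteRank_mem r F), h, ih]
  | zero =>
    have h1 := hφ.smul 0 0 (Submodule.zero_mem _)
    have h2 := hψ.smul 0 0 (Submodule.zero_mem _)
    simp only [smul_zero, zero_mul] at h1 h2
    rw [h1, h2]
  | add a b ha hb iha ihb => rw [hφ.add a ha b hb, hψ.add a ha b hb, iha, ihb]
  | smul c a ha iha => rw [hφ.smul c a ha, hψ.smul c a ha, iha]

theorem IsTraceBounded.exists_op {φ : Op Γ → ℂ} {C : ℝ} (h : IsTraceBounded φ C) (hC : 0 ≤ C) :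
    ∃ B : Op Γ, ∀ ρ ∈ TC Γ, φ ρ = tr (B * ρ) := by
  have hs : IsSesq fun x y : Hil Γ => φ (rankOne ℂ y x) :=
    { add_left := fun x y z => by
        rw [map_add, h.add _ (rankOne_mem _ _) _ (rankOne_mem _ _)]
      smul_left := fun c x z => by
        rw [map_smulₛₗ, h.smul _ _ (rankOne_mem _ _)]
      add_right := fun x y z => by
        rw [map_add, _root_.add_apply, h.add _ (rankOne_mem _ _) _ (rankOne_mem _ _)]
      smul_right := fun c x z => by
        rw [map_smul, _root_.smul_apply, h.smul _ _ (rankOne_mem _ _)] }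
  obtain ⟨B, hB⟩ := hs.exists_op (C := C) (fun x => by
    refine (h.bound _ (rankOne_self_mem x) (rankOne_self_nonneg x)).trans_eq ?_
    rw [tr_rankOne, inner_self_eq_norm_sq_to_K, ← RCLike.ofReal_pow]
    rfl) hC
  exact ⟨B, fun ρ hρ => h.eq_of_rankOne (isTraceBounded_tr_mul B) (fun x => by
    rw [tr_mul_rankOne, hB]) hρ⟩

end Functionals

/-! ## Quantum operations and their monotone limits -/

section QOp

variable {Γ Δ Θ : Ctx}

theorem IsQOp.nonneg {E : SOp Γ Δ} (hE : IsQOp E) {ρ : Op Γ} (h : ρ ∈ TC Γ) (h0 : 0 ≤ ρ) :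
    0 ≤ E ρ := by
  rw [nonneg_iff_inner] at h0 ⊢
  intro y
  have := hE.cp 1 (fun _ _ => ρ) (fun _ _ => h) (fun x => by simpa using h0 (x 0)) fun _ => y
  simpa using this

theorem IsQOp.map_sub {E : SOp Γ Δ} (hE : IsQOp E) {ρ σ : Op Γ} (h : ρ ∈ TC Γ)
    (h' : σ ∈ TC Γ) : E (ρ - σ) = E ρ - E σ := by
  rw [sub_eq_add_neg, hE.map_add _ h _ ((TC Γ).neg_mem h'), ← neg_one_smul ℂ σ,
    hE.map_smul _ _ h', neg_one_smul, ← sub_eq_add_neg]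

theorem IsQOp.mono {E : SOp Γ Δ} (hE : IsQOp E) {ρ σ : Op Γ} (h : ρ ∈ TC Γ)
    (h' : σ ∈ TC Γ) (hle : ρ ≤ σ) : E ρ ≤ E σ := by
  have := hE.nonneg ((TC Γ).sub_mem h' h) (sub_nonneg.2 hle)
  rwa [hE.map_sub h' h, sub_nonneg] at this

theorem IsQOp.congr {E E' : SOp Γ Δ} (hE : IsQOp E) (h : ∀ ρ ∈ TC Γ, E' ρ = E ρ) :
    IsQOp E' where
  map_tc ρ hρ := h ρ hρ ▸ hE.map_tc ρ hρ
  map_add ρ hρ σ hσ := by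
    rw [h _ ((TC Γ).add_mem hρ hσ), h ρ hρ, h σ hσ, hE.map_add ρ hρ σ hσ]
  map_smul c ρ hρ := by rw [h _ ((TC Γ).smul_mem c hρ), h ρ hρ, hE.map_smul c ρ hρ]
  cp n T hT hp y := by
    simp only [fun i j => h _ (hT i j)]
    exact hE.cp n T hT hp y
  tni ρ hρ h0 := h ρ hρ ▸ hE.tni ρ hρ h0

theorem IsQOp.comp {E : SOp Γ Δ} {F : SOp Δ Θ} (hF : IsQOp F) (hE : IsQOp E) :
    IsQOp fun ρ => F (E ρ) where
  map_tc ρ h := hF.map_tc _ (hE.map_tc ρ h)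
  map_add ρ h σ h' := by
    rw [hE.map_add ρ h σ h', hF.map_add _ (hE.map_tc ρ h) _ (hE.map_tc σ h')]
  map_smul c ρ h := by rw [hE.map_smul c ρ h, hF.map_smul c _ (hE.map_tc ρ h)]
  cp n T hT hp := hF.cp n (fun i j => E (T i j)) (fun i j => hE.map_tc _ (hT i j))
    (hE.cp n T hT hp)
  tni ρ h h0 := (hF.tni _ (hE.map_tc ρ h) (hE.nonneg h h0)).trans (hE.tni ρ h h0)

theorem isQOp_id : IsQOp fun ρ : Op Γ => ρ where
  map_tc _ h := h
  map_add _ _ _ _ := rfl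
  map_smul _ _ _ := rfl
  cp _ _ _ h := h
  tni _ _ _ := le_rfl

/-- The sum of two quantum operations whose sum is trace-non-increasing. -/
theorem IsQOp.add {E F : SOp Γ Δ} (hE : IsQOp E) (hF : IsQOp F)
    (h : ∀ ρ ∈ TC Γ, 0 ≤ ρ → (tr (E ρ)).re + (tr (F ρ)).re ≤ (tr ρ).re) :
    IsQOp fun ρ => E ρ + F ρ where
  map_tc ρ h := (TC Δ).add_mem (hE.map_tc ρ h) (hF.map_tc ρ h)
  map_add ρ h σ h' := by
    rw [hE.map_add ρ h σ h', hF.map_add ρ h σ h']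
    abel
  map_smul c ρ h := by rw [hE.map_smul c ρ h, hF.map_smul c ρ h, smul_add]
  cp n T hT hp y := by
    have := add_nonneg (hE.cp n T hT hp y) (hF.cp n T hT hp y)
    simpa only [_root_.add_apply, inner_add_right, Finset.sum_add_distrib] using this
  tni ρ hρ h0 := by
    rw [tr_add (hE.map_tc ρ hρ) (hF.map_tc ρ hρ), Complex.add_re]
    exact h ρ hρ h0

theorem IsQOp.isTraceBounded {E : SOp Γ Δ} (hE : IsQOp E) (A : Op Δ) :
    IsTraceBounded (fun ρ => tr (A * E ρ)) ‖A‖ where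
  add ρ h σ h' := by
    rw [hE.map_add ρ h σ h', tr_mul_add A (hE.map_tc ρ h) (hE.map_tc σ h')]
  smul c ρ h := by rw [hE.map_smul c ρ h, tr_mul_smul]
  bound ρ h h0 := (norm_tr_mul_le A (hE.map_tc ρ h) (hE.nonneg h h0)).trans
    (mul_le_mul_of_nonneg_left (hE.tni ρ h h0) (norm_nonneg A))

theorem inner_eq_re {ρ : Op Γ} (h : 0 ≤ ρ) (x : Hil Γ) :
    inner ℂ x (ρ x) = (((inner ℂ x (ρ x) : ℂ).re : ℝ) : ℂ) := by
  have := Complex.nonneg_iff.1 (nonneg_iff_inner.1 h x)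
  exact Complex.ext rfl (by rw [← this.2, Complex.ofReal_im])

theorem hasSum_re_tr {ρ : Op Γ} (h : ρ ∈ TC Γ) :
    HasSum (fun s : State Γ => (inner ℂ (ket s) (ρ (ket s)) : ℂ).re) (tr ρ).re :=
  Complex.hasSum_re (TC.summable h).hasSum

/-- `E` is the pointwise limit of `F` in the weak operator topology. -/
def IsWLim {ι : Type} (l : Filter ι) (F : ι → SOp Γ Δ) (E : SOp Γ Δ) : Prop :=
  ∀ ρ ∈ TC Γ, ∀ x y, Tendsto (fun i => inner ℂ x (F i ρ y)) l (𝓝 (inner ℂ x (E ρ y)))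

variable {ι : Type} [Preorder ι] [IsDirectedOrder ι] {F : ι → SOp Γ Δ}
  {E : SOp Γ Δ}

theorem IsWLim.le (hE : IsWLim atTop F E)
    (hm : ∀ ρ ∈ TC Γ, 0 ≤ ρ → Monotone fun i => F i ρ) {ρ : Op Γ} (h : ρ ∈ TC Γ)
    (h0 : 0 ≤ ρ) (i : ι) : F i ρ ≤ E ρ := by
  rw [le_iff_inner]
  intro x
  refine Monotone.ge_of_tendsto (f := fun i => inner ℂ x (F i ρ x)) ?_ (hE ρ h x x) i
  exact fun i j hij => le_iff_inner.1 (hm ρ h h0 hij) x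

variable [Nonempty ι]

theorem exists_isWLim (hF : ∀ i, IsQOp (F i))
    (hm : ∀ ρ ∈ TC Γ, 0 ≤ ρ → Monotone fun i => F i ρ) :
    ∃ E : SOp Γ Δ, IsWLim atTop F E := by
  have key : ∀ ρ ∈ TC Γ, ∃ T : Op Δ, ∀ x y,
      Tendsto (fun i => inner ℂ x (F i ρ y)) atTop (𝓝 (inner ℂ x (T y))) := by
    intro ρ hρ
    refine TC.induction (p := fun ρ => ∃ T : Op Δ, ∀ x y,
      Tendsto (fun i => inner ℂ x (F i ρ y)) atTop (𝓝 (inner ℂ x (T y)))) ?_ ?_ ?_ hρ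
    · intro ρ h h0
      have hle : ∀ i x, (inner ℂ x (F i ρ x) : ℂ).re ≤ (tr ρ).re * ‖x‖ ^ 2 := fun i x =>
        (inner_le_tr ((hF i).map_tc ρ h) ((hF i).nonneg h h0) x).trans
          (mul_le_mul_of_nonneg_right ((hF i).tni ρ h h0) (by positivity))
      refine exists_weak_limit (C := (tr ρ).re) (re_tr_nonneg h0) (fun i x => ?_) fun x => ?_
      · rw [inner_eq_re ((hF i).nonneg h h0), Complex.norm_real, Real.norm_of_nonneg]
        · exact hle i x
        · exact (Complex.nonneg_iff.1 (nonneg_iff_inner.1 ((hF i).nonneg h h0) x)).1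
      · have h1 : Monotone fun i => (inner ℂ x (F i ρ x) : ℂ).re := fun i j hij =>
          (Complex.le_def.1 (le_iff_inner.1 (hm ρ h h0 hij) x)).1
        have h2 := tendsto_atTop_ciSup h1 ⟨_, by
          rintro _ ⟨i, rfl⟩
          exact hle i x⟩
        refine ⟨_, ((Complex.continuous_ofReal.tendsto _).comp h2).congr fun i => ?_⟩
        exact (inner_eq_re ((hF i).nonneg h h0) x).symm
    · rintro ρ h σ h' ⟨S, hS⟩ ⟨T, hT⟩
      refine ⟨S + T, fun x y => ?_⟩
      simp only [fun i => (hF i).map_add ρ h σ h', _root_.add_apply, inner_add_right]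
      exact (hS x y).add (hT x y)
    · rintro c ρ h ⟨S, hS⟩
      refine ⟨c • S, fun x y => ?_⟩
      simp only [fun i => (hF i).map_smul c ρ h, _root_.smul_apply, inner_smul_right]
      exact (hS x y).const_mul c
  choose! E hE using key
  exact ⟨E, hE⟩

theorem IsWLim.isLUB (hE : IsWLim atTop F E)
    (hm : ∀ ρ ∈ TC Γ, 0 ≤ ρ → Monotone fun i => F i ρ) {ρ : Op Γ} (h : ρ ∈ TC Γ)
    (h0 : 0 ≤ ρ) : IsLUB (Set.range fun i => F i ρ) (E ρ) := by
  refine ⟨?_, fun T hT => ?_⟩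
  · rintro _ ⟨i, rfl⟩
    exact hE.le hm h h0 i
  · rw [le_iff_inner]
    exact fun x => le_of_tendsto' (hE ρ h x x) fun i => le_iff_inner.1 (hT ⟨i, rfl⟩) x

theorem IsWLim.isQOp (hE : IsWLim atTop F E) (hF : ∀ i, IsQOp (F i)) : IsQOp E := by
  have hnn : ∀ ρ ∈ TC Γ, 0 ≤ ρ → 0 ≤ E ρ := fun ρ h h0 => nonneg_iff_inner.2 fun x =>
    ge_of_tendsto' (hE ρ h x x) fun i => nonneg_iff_inner.1 ((hF i).nonneg h h0) x
  have hsum : ∀ ρ ∈ TC Γ, 0 ≤ ρ → ∀ S : Finset (State Δ),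
      ∑ s ∈ S, (inner ℂ (ket s) (E ρ (ket s)) : ℂ).re ≤ (tr ρ).re := by
    intro ρ h h0 S
    refine le_of_tendsto' (tendsto_finsetSum S fun s _ =>
      (Complex.continuous_re.tendsto _).comp (hE ρ h (ket s) (ket s))) fun i => ?_
    refine (sum_le_hasSum S (fun s _ => ?_) (hasSum_re_tr ((hF i).map_tc ρ h))).trans
      ((hF i).tni ρ h h0)
    exact (Complex.nonneg_iff.1 (nonneg_iff_inner.1 ((hF i).nonneg h h0) _)).1
  have hadd : ∀ ρ ∈ TC Γ, ∀ σ ∈ TC Γ, E (ρ + σ) = E ρ + E σ := fun ρ h σ h' =>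
    ext_inner_right fun x y => tendsto_nhds_unique (hE _ ((TC Γ).add_mem h h') x y) (by
      simp only [fun i => (hF i).map_add ρ h σ h', _root_.add_apply, inner_add_right]
      exact (hE ρ h x y).add (hE σ h' x y))
  have hsmul : ∀ (c : ℂ), ∀ ρ ∈ TC Γ, E (c • ρ) = c • E ρ := fun c ρ h =>
    ext_inner_right fun x y => tendsto_nhds_unique (hE _ ((TC Γ).smul_mem c h) x y) (by
      simp only [fun i => (hF i).map_smul c ρ h, _root_.smul_apply, inner_smul_right]
      exact (hE ρ h x y).const_mul c)
  have hre : ∀ ρ ∈ TC Γ, 0 ≤ ρ → ∀ s, 0 ≤ (inner ℂ (ket s) (E ρ (ket s)) : ℂ).re :=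
    fun ρ h h0 s => (Complex.nonneg_iff.1 (nonneg_iff_inner.1 (hnn ρ h h0) _)).1
  have htc : ∀ ρ ∈ TC Γ, E ρ ∈ TC Δ := by
    intro ρ h
    refine TC.induction (p := fun ρ => E ρ ∈ TC Δ) ?_ ?_ ?_ h
    · intro ρ h h0
      refine Submodule.subset_span ⟨hnn ρ h h0, ?_⟩
      have h1 := Complex.hasSum_ofReal.2
        (summable_of_sum_le (hre ρ h h0) (hsum ρ h h0)).hasSum
      exact h1.summable.congr fun s => (inner_eq_re (hnn ρ h h0) _).symm
    · intro ρ h σ h' h1 h2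
      beta_reduce at h1 h2 ⊢
      exact hadd ρ h σ h' ▸ (TC Δ).add_mem h1 h2
    · intro c ρ h h1
      beta_reduce at h1 ⊢
      exact hsmul c ρ h ▸ (TC Δ).smul_mem c h1
  refine ⟨htc, hadd, hsmul, fun n T hT hp y => ?_, fun ρ h h0 => ?_⟩
  · exact ge_of_tendsto' (tendsto_finsetSum _ fun i _ => tendsto_finsetSum _ fun j _ =>
      hE _ (hT i j) (y i) (y j)) fun k => (hF k).cp n T hT hp y
  · rw [← (hasSum_re_tr (htc ρ h)).tsum_eq]
    exact Real.tsum_le_of_sum_le (hre ρ h h0) (hsum ρ h h0)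

theorem IsWLim.tendsto_re_tr (hE : IsWLim atTop F E) (hF : ∀ i, IsQOp (F i))
    (hm : ∀ ρ ∈ TC Γ, 0 ≤ ρ → Monotone fun i => F i ρ) {ρ : Op Γ} (h : ρ ∈ TC Γ)
    (h0 : 0 ≤ ρ) : Tendsto (fun i => (tr (F i ρ)).re) atTop (𝓝 (tr (E ρ)).re) := by
  have hE' := hE.isQOp hF
  rw [tendsto_order]
  refine ⟨fun a ha => ?_, fun a ha => Eventually.of_forall fun i => lt_of_le_of_lt
    (re_tr_mono ((hF i).map_tc ρ h) (hE'.map_tc ρ h) (hE.le hm h h0 i)) ha⟩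
  obtain ⟨S, hS⟩ := ((hasSum_re_tr (hE'.map_tc ρ h)).eventually (lt_mem_nhds ha)).exists
  have h1 : Tendsto (fun i => ∑ s ∈ S, (inner ℂ (ket s) (F i ρ (ket s)) : ℂ).re) atTop
      (𝓝 (∑ s ∈ S, (inner ℂ (ket s) (E ρ (ket s)) : ℂ).re)) :=
    tendsto_finsetSum S fun s _ =>
      (Complex.continuous_re.tendsto _).comp (hE ρ h (ket s) (ket s))
  refine (h1.eventually (lt_mem_nhds hS)).mono fun i hi => hi.trans_le ?_
  refine sum_le_hasSum S (fun s _ => ?_) (hasSum_re_tr ((hF i).map_tc ρ h))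
  exact (Complex.nonneg_iff.1 (nonneg_iff_inner.1 ((hF i).nonneg h h0) _)).1

theorem IsWLim.tendsto_tr_mul (hE : IsWLim atTop F E) (hF : ∀ i, IsQOp (F i))
    (hm : ∀ ρ ∈ TC Γ, 0 ≤ ρ → Monotone fun i => F i ρ) (A : Op Δ) {ρ : Op Γ} (h : ρ ∈ TC Γ) :
    Tendsto (fun i => tr (A * F i ρ)) atTop (𝓝 (tr (A * E ρ))) := by
  have hE' := hE.isQOp hF
  refine TC.induction (p := fun ρ =>
    Tendsto (fun i => tr (A * F i ρ)) atTop (𝓝 (tr (A * E ρ)))) ?_ ?_ ?_ h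
  · intro ρ h h0
    exact (isTraceBounded_tr_mul A).tendsto (hE'.map_tc ρ h) (fun i => (hF i).map_tc ρ h)
      (hE.le hm h h0) (hE.tendsto_re_tr hF hm h h0)
  · intro ρ h σ h' h1 h2
    beta_reduce at h1 h2 ⊢
    rw [(hE'.isTraceBounded A).add ρ h σ h']
    exact (h1.add h2).congr fun i => (((hF i).isTraceBounded A).add ρ h σ h').symm
  · intro c ρ h h1
    beta_reduce at h1 ⊢
    rw [(hE'.isTraceBounded A).smul c ρ h]
    exact (h1.const_mul c).congr fun i => (((hF i).isTraceBounded A).smul c ρ h).symm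

theorem IsSup.isWLim {F : ℕ → SOp Γ Δ} (h : IsSup F E) (hF : ∀ i, IsQOp (F i))
    (hm : ∀ ρ ∈ TC Γ, 0 ≤ ρ → Monotone fun i => F i ρ) : IsWLim atTop F E := by
  obtain ⟨E', hE'⟩ := exists_isWLim hF hm
  have hq := hE'.isQOp hF
  have heq : ∀ ρ ∈ TC Γ, E ρ = E' ρ := by
    intro ρ hρ
    refine TC.induction (p := fun ρ => E ρ = E' ρ) ?_ ?_ ?_ hρ
    · exact fun ρ hρ h0 => (h.2 ρ hρ h0).unique (hE'.isLUB hm hρ h0)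
    · intro ρ hρ σ hσ h1 h2
      beta_reduce at h1 h2 ⊢
      rw [h.1.map_add ρ hρ σ hσ, hq.map_add ρ hρ σ hσ, h1, h2]
    · intro c ρ hρ h1
      beta_reduce at h1 ⊢
      rw [h.1.map_smul c ρ hρ, hq.map_smul c ρ hρ, h1]
  intro ρ hρ x y
  rw [heq ρ hρ]
  exact hE' ρ hρ x y

theorem isSup_sup {F : ℕ → SOp Γ Δ} (hF : ∀ i, IsQOp (F i))
    (hm : ∀ ρ ∈ TC Γ, 0 ≤ ρ → Monotone fun i => F i ρ) : IsSup F (sup F) := by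
  obtain ⟨E', hE'⟩ := exists_isWLim hF hm
  exact Classical.epsilon_spec (p := IsSup F)
    ⟨E', hE'.isQOp hF, fun ρ h h0 => hE'.isLUB hm h h0⟩

/-! ## Duals -/

theorem IsQOp.tr_dual {E : SOp Γ Δ} (hE : IsQOp E) (A : Op Δ) :
    ∀ ρ ∈ TC Γ, tr (A * E ρ) = tr (dual E A * ρ) :=
  Classical.epsilon_spec (p := fun B : Op Γ => ∀ ρ ∈ TC Γ, tr (A * E ρ) = tr (B * ρ))
    ((hE.isTraceBounded A).exists_op (norm_nonneg A))

theorem dual_eq {E : SOp Γ Δ} {A : Op Δ} {B : Op Γ}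
    (h : ∀ ρ ∈ TC Γ, tr (A * E ρ) = tr (B * ρ)) : dual E A = B := by
  have h1 := Classical.epsilon_spec
    (p := fun B : Op Γ => ∀ ρ ∈ TC Γ, tr (A * E ρ) = tr (B * ρ)) ⟨B, h⟩
  exact op_ext_tr fun ρ hρ => (h1 ρ hρ).symm.trans (h ρ hρ)

theorem IsQOp.dual_congr {E E' : SOp Γ Δ} (hE : IsQOp E) (h : ∀ ρ ∈ TC Γ, E' ρ = E ρ)
    (A : Op Δ) : dual E' A = dual E A :=
  dual_eq fun ρ hρ => by rw [h ρ hρ, hE.tr_dual A ρ hρ]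

theorem IsQOp.dual_add {E : SOp Γ Δ} (hE : IsQOp E) (A B : Op Δ) :
    dual E (A + B) = dual E A + dual E B :=
  dual_eq fun ρ hρ => by
    rw [tr_add_mul _ _ (hE.map_tc ρ hρ), tr_add_mul _ _ hρ, hE.tr_dual A ρ hρ,
      hE.tr_dual B ρ hρ]

theorem IsQOp.dual_sub {E : SOp Γ Δ} (hE : IsQOp E) (A B : Op Δ) :
    dual E (A - B) = dual E A - dual E B :=
  dual_eq fun ρ hρ => by
    rw [tr_sub_mul _ _ (hE.map_tc ρ hρ), tr_sub_mul _ _ hρ, hE.tr_dual A ρ hρ,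
      hE.tr_dual B ρ hρ]

theorem IsQOp.dual_comp {E : SOp Γ Δ} {F : SOp Δ Θ} (hF : IsQOp F) (hE : IsQOp E) (A : Op Θ) :
    dual (fun ρ => F (E ρ)) A = dual E (dual F A) :=
  dual_eq fun ρ hρ => by
    rw [hF.tr_dual A _ (hE.map_tc ρ hρ), hE.tr_dual _ ρ hρ]

theorem dual_id (A : Op Γ) : dual (fun ρ : Op Γ => ρ) A = A :=
  dual_eq fun _ _ => rfl

theorem dual_zero (A : Op Δ) : dual (fun _ : Op Γ => (0 : Op Δ)) A = 0 :=
  dual_eq fun _ _ => by rw [mul_zero, zero_mul, tr_zero, tr_zero]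

theorem IsQOp.dual_add_left {E F : SOp Γ Δ} (hE : IsQOp E) (hF : IsQOp F) (A : Op Δ) :
    dual (fun ρ => E ρ + F ρ) A = dual E A + dual F A :=
  dual_eq fun ρ hρ => by
    rw [tr_mul_add _ (hE.map_tc ρ hρ) (hF.map_tc ρ hρ), tr_add_mul _ _ hρ, hE.tr_dual A ρ hρ,
      hF.tr_dual A ρ hρ]

theorem IsWLim.tendsto_dual (hE : IsWLim atTop F E) (hF : ∀ i, IsQOp (F i))
    (hm : ∀ ρ ∈ TC Γ, 0 ≤ ρ → Monotone fun i => F i ρ) (A : Op Δ) (x y : Hil Γ) :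
    Tendsto (fun i => inner ℂ x (dual (F i) A y)) atTop (𝓝 (inner ℂ x (dual E A y))) := by
  have h := hE.tendsto_tr_mul hF hm A (rankOne_mem y x)
  simpa only [fun i => (hF i).tr_dual A _ (rankOne_mem y x),
    (hE.isQOp hF).tr_dual A _ (rankOne_mem y x), tr_mul_rankOne] using h

end QOp

open ContinuousLinearMap

/-! ## Kraus operators -/

section Kraus

variable {Γ Δ Θ : Ctx}

/-- The map `ρ ↦ K ρ K†`. -/
noncomputable def conj (K : Hil Γ →L[ℂ] Hil Δ) : SOp Γ Δ := fun ρ => K ∘L ρ ∘L adjoint K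

theorem conj_hs (K : Hil Γ →L[ℂ] Hil Δ) (r : Op Γ) :
    conj K (adjoint r ∘L r) = adjoint (r ∘L adjoint K) ∘L (r ∘L adjoint K) := by
  rw [adjoint_comp, adjoint_adjoint]
  rfl

theorem conj_mem_tc (K : Hil Γ →L[ℂ] Hil Δ) {ρ : Op Γ} (h : ρ ∈ TC Γ) : conj K ρ ∈ TC Δ := by
  refine TC.induction (p := fun ρ => conj K ρ ∈ TC Δ) ?_ ?_ ?_ h
  · intro ρ h h0
    obtain ⟨r, hr, rfl⟩ := TC.exists_hs h h0
    exact conj_hs K r ▸ (hr.comp_right (adjoint K)).mem_tc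
  · intro ρ _ σ _ h1 h2
    beta_reduce at h1 h2 ⊢
    have : conj K (ρ + σ) = conj K ρ + conj K σ := by
      ext1 x
      simp [conj]
    exact this ▸ (TC Δ).add_mem h1 h2
  · intro c ρ _ h1
    beta_reduce at h1 ⊢
    have : conj K (c • ρ) = c • conj K ρ := by
      ext1 x
      simp [conj]
    exact this ▸ (TC Δ).smul_mem c h1

theorem re_tr_conj_hs (K : Hil Γ →L[ℂ] Hil Δ) {r : Op Γ} (hr : IsHS r) :
    HasSum (fun s => ‖K (adjoint r (ket s))‖ ^ 2) (tr (conj K (adjoint r ∘L r))).re := by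
  have h := hr.comp_right (adjoint K)
  rw [conj_hs, h.tr_eq, Complex.ofReal_re]
  have h1 := h.adjoint
  rw [adjoint_comp, adjoint_adjoint] at h1 ⊢
  exact h1.hasSum

theorem re_tr_hs {r : Op Γ} (hr : IsHS r) :
    HasSum (fun s => ‖adjoint r (ket s)‖ ^ 2) (tr (adjoint r ∘L r)).re := by
  rw [hr.tr_eq, Complex.ofReal_re]
  exact hr.adjoint.hasSum

theorem isQOp_conj {K : Hil Γ →L[ℂ] Hil Δ} (hK : ∀ x, ‖K x‖ ≤ ‖x‖) : IsQOp (conj K) where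
  map_tc ρ h := conj_mem_tc K h
  map_add ρ _ σ _ := by
    ext1 x
    simp [conj]
  map_smul c ρ _ := by
    ext1 x
    simp [conj]
  cp n T hT hp y := by
    have := hp fun i => adjoint K (y i)
    simp only [adjoint_inner_left] at this
    exact this
  tni ρ h h0 := by
    obtain ⟨r, hr, rfl⟩ := TC.exists_hs h h0
    exact hasSum_le (fun s => pow_le_pow_left₀ (norm_nonneg _) (hK _) 2) (re_tr_conj_hs K hr)
      (re_tr_hs hr)

theorem tr_mul_conj (K : Hil Γ →L[ℂ] Hil Δ) (hK : ∀ x, ‖K x‖ ≤ ‖x‖) (A : Op Δ) {ρ : Op Γ}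
    (h : ρ ∈ TC Γ) : tr (A * conj K ρ) = tr ((adjoint K ∘L A ∘L K) * ρ) := by
  refine ((isQOp_conj hK).isTraceBounded A).eq_of_rankOne
    (isTraceBounded_tr_mul (adjoint K ∘L A ∘L K)) (fun x => ?_) h
  have h1 : conj K (rankOne ℂ x x) = rankOne ℂ (K x) (K x) := by
    ext1 y
    simp [conj, adjoint_inner_right]
  rw [h1, tr_mul_rankOne, tr_mul_rankOne, comp_apply, comp_apply, adjoint_inner_right]

theorem dual_conj {K : Hil Γ →L[ℂ] Hil Δ} (hK : ∀ x, ‖K x‖ ≤ ‖x‖) (A : Op Δ) :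
    dual (conj K) A = adjoint K ∘L A ∘L K :=
  dual_eq fun _ h => tr_mul_conj K hK A h

theorem hasSum_iff_atTop {κ : Type} {f : κ → ℂ} {a : ℂ} :
    HasSum f a ↔ Tendsto (fun S : Finset κ => ∑ k ∈ S, f k) atTop (𝓝 a) := by
  rw [HasSum, SummationFilter.unconditional_filter]

theorem wsum_eq {κ H K : Type} [NormedAddCommGroup H] [InnerProductSpace ℂ H]
    [NormedAddCommGroup K] [InnerProductSpace ℂ K] [CompleteSpace K] {A : κ → H →L[ℂ] K}
    {T : H →L[ℂ] K} (h : ∀ x y, HasSum (fun k => inner ℂ x (A k y)) (inner ℂ x (T y))) :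
    wsum A = T := by
  have h1 : HasSum (fun k => ContinuousLinearMapWOT.ofCLM (A k))
      (ContinuousLinearMapWOT.ofCLM T) := by
    rw [HasSum, ContinuousLinearMapWOT.tendsto_iff_forall_inner_apply_tendsto]
    intro y x
    refine (h x y).congr fun S => ?_
    rw [← inner_sum]
    congr 1
    classical
    induction S using Finset.induction_on with
    | empty => simp
    | insert a S ha ih => rw [Finset.sum_insert ha, Finset.sum_insert ha, ih]; rfl
  rw [wsum, h1.tsum_eq]

variable {κ : Type} {E : κ → SOp Γ Δ}

theorem isQOp_sum (hE : ∀ k, IsQOp (E k))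
    (hs : ∀ ρ ∈ TC Γ, 0 ≤ ρ → ∀ S : Finset κ, ∑ k ∈ S, (tr (E k ρ)).re ≤ (tr ρ).re)
    (S : Finset κ) : IsQOp (fun ρ => ∑ k ∈ S, E k ρ) ∧
      (∀ ρ ∈ TC Γ, (tr (∑ k ∈ S, E k ρ)).re = ∑ k ∈ S, (tr (E k ρ)).re) ∧
      ∀ A, dual (fun ρ => ∑ k ∈ S, E k ρ) A = ∑ k ∈ S, dual (E k) A := by
  classical
  induction S using Finset.induction_on with
  | empty => exact ⟨by simpa using isQOp_zero, by simp [tr_zero], fun A => by simp [dual_zero]⟩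
  | insert a S ha ih =>
    obtain ⟨h1, h2, h3⟩ := ih
    have h4 : ∀ ρ ∈ TC Γ, 0 ≤ ρ →
        (tr (E a ρ)).re + (tr (∑ k ∈ S, E k ρ)).re ≤ (tr ρ).re := by
      intro ρ h h0
      rw [h2 ρ h]
      have := hs ρ h h0 (insert a S)
      rwa [Finset.sum_insert ha] at this
    simp only [Finset.sum_insert ha]
    refine ⟨(hE a).add h1 h4, fun ρ h => ?_, fun A => ?_⟩
    · rw [tr_add ((hE a).map_tc ρ h) (h1.map_tc ρ h), Complex.add_re, h2 ρ h]
    · rw [(hE a).dual_add_left h1, h3]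

theorem isQOp_wsum (hE : ∀ k, IsQOp (E k))
    (hs : ∀ ρ ∈ TC Γ, 0 ≤ ρ → ∀ S : Finset κ, ∑ k ∈ S, (tr (E k ρ)).re ≤ (tr ρ).re) :
    IsQOp (fun ρ => wsum fun k => E k ρ) ∧
      (∀ ρ ∈ TC Γ, ∀ x y, HasSum (fun k => inner ℂ x (E k ρ y))
        (inner ℂ x ((wsum fun k => E k ρ) y))) ∧
      ∀ A x y, HasSum (fun k => inner ℂ x (dual (E k) A y))
        (inner ℂ x (dual (fun ρ => wsum fun k => E k ρ) A y)) := by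
  have hF := fun S => (isQOp_sum hE hs S).1
  have hm : ∀ ρ ∈ TC Γ, 0 ≤ ρ → Monotone fun S : Finset κ => ∑ k ∈ S, E k ρ :=
    fun ρ h h0 S T hST => Finset.sum_le_sum_of_subset_of_nonneg hST
      fun k _ _ => (hE k).nonneg h h0
  obtain ⟨E', hE'⟩ := exists_isWLim hF hm
  have heq : ∀ ρ ∈ TC Γ, (wsum fun k => E k ρ) = E' ρ := fun ρ h => wsum_eq fun x y => by
    simpa only [hasSum_iff_atTop, _root_.sum_apply, inner_sum] using hE' ρ h x y
  have hq := hE'.isQOp hF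
  refine ⟨hq.congr heq, fun ρ h x y => ?_, fun A x y => ?_⟩
  · rw [heq ρ h]
    simpa only [hasSum_iff_atTop, _root_.sum_apply, inner_sum] using hE' ρ h x y
  · rw [hq.dual_congr heq]
    have := hE'.tendsto_dual hF hm A x y
    simpa only [hasSum_iff_atTop, fun S => (isQOp_sum hE hs S).2.2 A, _root_.sum_apply, inner_sum] using this

variable {K : κ → Hil Γ →L[ℂ] Hil Δ} {D D' : κ → SOp Δ Θ}

theorem norm_le_of_kraus (hK : ∀ x S, ∑ k ∈ S, ‖K k x‖ ^ 2 ≤ ‖x‖ ^ 2) (k : κ) (x : Hil Γ) :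
    ‖K k x‖ ≤ ‖x‖ := by
  have := hK x {k}
  rw [Finset.sum_singleton] at this
  exact (sq_le_sq₀ (norm_nonneg _) (norm_nonneg _)).1 this

theorem kraus_trace_le (hK : ∀ x S, ∑ k ∈ S, ‖K k x‖ ^ 2 ≤ ‖x‖ ^ 2) (hD : ∀ k, IsQOp (D k))
    {ρ : Op Γ} (h : ρ ∈ TC Γ) (h0 : 0 ≤ ρ) (S : Finset κ) :
    ∑ k ∈ S, (tr (D k (conj (K k) ρ))).re ≤ (tr ρ).re := by
  refine (Finset.sum_le_sum fun k _ => (hD k).tni _ (conj_mem_tc (K k) h)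
    ((isQOp_conj (norm_le_of_kraus hK k)).nonneg h h0)).trans ?_
  obtain ⟨r, hr, rfl⟩ := TC.exists_hs h h0
  exact hasSum_le (fun s => hK _ S) (hasSum_sum fun k _ => re_tr_conj_hs (K k) hr) (re_tr_hs hr)

theorem isQOp_kraus (hK : ∀ x S, ∑ k ∈ S, ‖K k x‖ ^ 2 ≤ ‖x‖ ^ 2) (hD : ∀ k, IsQOp (D k)) :
    IsQOp fun ρ => wsum fun k => D k (conj (K k) ρ) :=
  (isQOp_wsum (fun k => (hD k).comp (isQOp_conj (norm_le_of_kraus hK k)))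
    fun _ h h0 => kraus_trace_le hK hD h h0).1

theorem kraus_mono (hK : ∀ x S, ∑ k ∈ S, ‖K k x‖ ^ 2 ≤ ‖x‖ ^ 2) (hD : ∀ k, IsQOp (D k))
    (hD' : ∀ k, IsQOp (D' k)) (hle : ∀ k, ∀ ρ ∈ TC Δ, 0 ≤ ρ → D k ρ ≤ D' k ρ) {ρ : Op Γ}
    (h : ρ ∈ TC Γ) (h0 : 0 ≤ ρ) :
    (wsum fun k => D k (conj (K k) ρ)) ≤ wsum fun k => D' k (conj (K k) ρ) := by
  have hc := fun k => isQOp_conj (norm_le_of_kraus hK k)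
  have h1 := (isQOp_wsum (fun k => (hD k).comp (hc k)) fun _ h h0 =>
    kraus_trace_le hK hD h h0).2.1 ρ h
  have h2 := (isQOp_wsum (fun k => (hD' k).comp (hc k)) fun _ h h0 =>
    kraus_trace_le hK hD' h h0).2.1 ρ h
  rw [le_iff_inner]
  exact fun x => hasSum_le (fun k => le_iff_inner.1
    (hle k _ ((hc k).map_tc ρ h) ((hc k).nonneg h h0)) x) (h1 x x) (h2 x x)

theorem hasSum_dual_kraus (hK : ∀ x S, ∑ k ∈ S, ‖K k x‖ ^ 2 ≤ ‖x‖ ^ 2)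
    (hD : ∀ k, IsQOp (D k)) (A : Op Θ) (x y : Hil Γ) :
    HasSum (fun k => inner ℂ (K k x) (dual (D k) A (K k y)))
      (inner ℂ x (dual (fun ρ => wsum fun k => D k (conj (K k) ρ)) A y)) := by
  have hc := fun k => isQOp_conj (norm_le_of_kraus hK k)
  have := (isQOp_wsum (fun k => (hD k).comp (hc k)) fun _ h h0 =>
    kraus_trace_le hK hD h h0).2.2 A x y
  refine this.congr fun S => Finset.sum_congr rfl fun k _ => ?_
  beta_reduce
  rw [(hD k).dual_comp (hc k), dual_conj (norm_le_of_kraus hK k), comp_apply, comp_apply,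
    adjoint_inner_right]

theorem dual_kraus (hK : ∀ x S, ∑ k ∈ S, ‖K k x‖ ^ 2 ≤ ‖x‖ ^ 2)
    (hD : ∀ k, IsQOp (D k)) (A : Op Θ) :
    (wsum fun k => adjoint (K k) ∘L dual (D k) A ∘L K k) =
      dual (fun ρ => wsum fun k => D k (conj (K k) ρ)) A :=
  wsum_eq fun x y => by
    simpa only [comp_apply, adjoint_inner_right] using hasSum_dual_kraus hK hD A x y

theorem hasSum_inner_kraus (hK : ∀ x, HasSum (fun k => ‖K k x‖ ^ 2) (‖x‖ ^ 2)) (x y : Hil Γ) :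
    HasSum (fun k => inner ℂ (K k x) (K k y)) (inner ℂ x y : ℂ) := by
  have h := tendsto_inner_of_quadratic (l := atTop) (T' := (1 : Op Γ))
    (T := fun S : Finset κ => ∑ k ∈ S, adjoint (K k) ∘L K k) (fun x => by
      have := Complex.hasSum_ofReal.2 (hK x)
      simp only [_root_.sum_apply, inner_sum, comp_apply, adjoint_inner_right, one_apply_eq_self,
        inner_self_eq_norm_sq_to_K]
      simpa [hasSum_iff_atTop] using this) x y
  simpa only [hasSum_iff_atTop, _root_.sum_apply, inner_sum, comp_apply, adjoint_inner_right, one_apply_eq_self]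
    using h

/-- The dual of a measurement followed by quantum operations, in liberal form. -/
theorem dual_kraus_liberal (hK : ∀ x, HasSum (fun k => ‖K k x‖ ^ 2) (‖x‖ ^ 2))
    (hD : ∀ k, IsQOp (D k)) (A : Op Θ) :
    (wsum fun k => adjoint (K k) ∘L (dual (D k) A + (1 - dual (D k) 1)) ∘L K k) =
      dual (fun ρ => wsum fun k => D k (conj (K k) ρ)) A +
        (1 - dual (fun ρ => wsum fun k => D k (conj (K k) ρ)) 1) := by
  have hK' : ∀ x S, ∑ k ∈ S, ‖K k x‖ ^ 2 ≤ ‖x‖ ^ 2 := fun x S =>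
    sum_le_hasSum S (fun _ _ => by positivity) (hK x)
  refine wsum_eq fun x y => ?_
  have := (hasSum_dual_kraus hK' hD A x y).add
    ((hasSum_inner_kraus hK x y).sub (hasSum_dual_kraus hK' hD 1 x y))
  simpa only [comp_apply, adjoint_inner_right, _root_.add_apply, _root_.sub_apply,
    inner_add_right, inner_sub_right, one_apply_eq_self] using this

theorem dual_one_nonneg {T : SOp Γ Δ} (hT : IsQOp T) : 0 ≤ dual T 1 := by
  rw [nonneg_iff_inner]
  intro x
  rw [← tr_mul_rankOne, ← hT.tr_dual 1 _ (rankOne_mem x x), one_mul]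
  have h := hT.nonneg (rankOne_self_mem x) (rankOne_self_nonneg x)
  exact Complex.nonneg_iff.2 ⟨re_tr_nonneg h, (tr_im h).symm⟩

theorem dual_one_le_one {T : SOp Γ Δ} (hT : IsQOp T) : dual T 1 ≤ 1 := by
  rw [le_iff_inner]
  intro x
  rw [← tr_mul_rankOne, ← tr_mul_rankOne, ← hT.tr_dual 1 _ (rankOne_mem x x), one_mul, one_mul]
  have h0 := rankOne_self_nonneg x
  have h := hT.nonneg (rankOne_self_mem x) h0
  exact Complex.le_def.2 ⟨hT.tni _ (rankOne_self_mem x) h0, by rw [tr_im h, tr_im h0]⟩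

/-- Every effect is the pullback of the identity along a quantum operation into any space. -/
theorem exists_dual_one_eq {L : Op Γ} (h0 : 0 ≤ L) (h1 : L ≤ 1) (Δ : Ctx) :
    ∃ Z : SOp Γ Δ, IsQOp Z ∧ dual Z 1 = L := by
  obtain ⟨k, rfl⟩ := exists_adjoint_comp_self h0
  have hk : ∀ x, ‖k x‖ ^ 2 ≤ ‖x‖ ^ 2 := by
    intro x
    have := (Complex.le_def.1 (le_iff_inner.1 h1 x)).1
    rw [comp_apply, adjoint_inner_right, one_apply_eq_self, inner_self_eq_norm_sq_to_K,
      inner_self_eq_norm_sq_to_K, ← RCLike.ofReal_pow, ← RCLike.ofReal_pow] at this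
    exact this
  have hn : ‖(ket (State.zero Δ) : Hil Δ)‖ = 1 := by
    rw [ket]
    simp
  let K : State Γ → Hil Γ →L[ℂ] Hil Δ := fun s =>
    rankOne ℂ (ket (State.zero Δ)) (adjoint k (ket s))
  have hKx : ∀ s x, K s x = k x s • ket (State.zero Δ) := fun s x => by
    rw [rankOne_apply, adjoint_inner_left, inner_ket_left]
  have hK : ∀ x S, ∑ s ∈ S, ‖K s x‖ ^ 2 ≤ ‖x‖ ^ 2 := by
    intro x S
    simp only [hKx, norm_smul, hn, mul_one]
    exact (sum_le_hasSum S (fun _ _ => by positivity) (k x).hasSum_sq).trans (hk x)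
  have hid : ∀ _ : State Γ, IsQOp fun ρ : Op Δ => ρ := fun _ => isQOp_id
  refine ⟨_, isQOp_kraus hK hid, ?_⟩
  rw [← dual_kraus hK hid]
  refine wsum_eq fun x y => ?_
  simp only [dual_id, comp_apply, adjoint_inner_right, one_apply_eq_self, hKx, inner_smul_left,
    inner_smul_right, inner_self_eq_norm_sq_to_K, hn]
  simpa [mul_comm] using hasSum_inner_coord (k x) (k y)

end Kraus

/-! ## Amplifications -/

section Ampl

variable {X Y R : Type}

/-- The component of a vector along a basis label of the first tensor factor. -/
noncomputable def slice (Φ : Y ≃ R × X) (r : R) : Ell Y →L[ℂ] Ell X :=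
  restr (fun x => Φ.symm (r, x)) (fun a b h => by simpa using h)

theorem slice_apply (Φ : Y ≃ R × X) (r : R) (f : Ell Y) (x : X) :
    slice Φ r f x = f (Φ.symm (r, x)) := rfl

theorem slice_ampl (Φ : Y ≃ R × X) (A : Ell X →L[ℂ] Ell X) (r : R) (f : Ell Y) :
    slice Φ r (ampl Φ A f) = A (slice Φ r f) := by
  ext x
  have h : slice Φ r (ampl Φ A f) x =
      A (slice Φ (Φ (Φ.symm (r, x))).1 f) (Φ (Φ.symm (r, x))).2 := rfl
  rw [h, Equiv.apply_symm_apply]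

theorem slice_ext (Φ : Y ≃ R × X) {f g : Ell Y} (h : ∀ r, slice Φ r f = slice Φ r g) :
    f = g := by
  ext y
  have h1 : ∀ f : Ell Y, slice Φ (Φ y).1 f (Φ y).2 = f y := fun f => by
    rw [slice_apply, Prod.mk.eta, Equiv.symm_apply_apply]
  rw [← h1 f, ← h1 g, h]

theorem hasSum_norm_slice (Φ : Y ≃ R × X) (f : Ell Y) :
    HasSum (fun r => ‖slice Φ r f‖ ^ 2) (‖f‖ ^ 2) :=
  ((Equiv.hasSum_iff Φ.symm).2 f.hasSum_sq).prod_fiberwise fun r => (slice Φ r f).hasSum_sq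

theorem hasSum_inner_slice (Φ : Y ≃ R × X) (f g : Ell Y) :
    HasSum (fun r => inner ℂ (slice Φ r f) (slice Φ r g)) (inner ℂ f g : ℂ) :=
  ((Equiv.hasSum_iff Φ.symm).2 (hasSum_inner_coord f g)).prod_fiberwise
    fun r => hasSum_inner_coord (slice Φ r f) (slice Φ r g)

theorem ampl_mul (Φ : Y ≃ R × X) (A B : Ell X →L[ℂ] Ell X) :
    ampl Φ (A * B) = ampl Φ A * ampl Φ B := by
  ext1 f
  refine slice_ext Φ fun r => ?_
  rw [mul_apply_eq_comp, slice_ampl, slice_ampl, slice_ampl, mul_apply_eq_comp]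

theorem ampl_one (Φ : Y ≃ R × X) : ampl Φ (1 : Ell X →L[ℂ] Ell X) = 1 := by
  ext1 f
  refine slice_ext Φ fun r => ?_
  rw [slice_ampl, one_apply_eq_self, one_apply_eq_self]

theorem ampl_star (Φ : Y ≃ R × X) (A : Ell X →L[ℂ] Ell X) :
    ampl Φ (star A) = star (ampl Φ A) := by
  refine ext_inner_right fun f g => ?_
  rw [star_eq_adjoint, star_eq_adjoint, adjoint_inner_right]
  have h1 := hasSum_inner_slice Φ f (ampl Φ (adjoint A) g)
  have h2 := hasSum_inner_slice Φ (ampl Φ A f) g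
  simp only [slice_ampl, adjoint_inner_right] at h1 h2
  exact h1.unique h2

theorem HasSum.swap_of_nonneg {f : X × Y → ℝ} (h0 : ∀ p, 0 ≤ f p) {g : X → ℝ} {h : Y → ℝ}
    (hs : Summable h) (hg : ∀ x, HasSum (fun y => f (x, y)) (g x))
    (hh : ∀ y, HasSum (fun x => f (x, y)) (h y)) : HasSum g (∑' y, h y) := by
  have h1 : Summable fun p : Y × X => f (p.2, p.1) := by
    rw [summable_prod_of_nonneg fun p => h0 _]
    exact ⟨fun y => (hh y).summable, by simpa only [fun y => (hh y).tsum_eq] using hs⟩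
  exact HasSum.swap ((Equiv.summable_iff (Equiv.prodComm X Y)).2 h1) hg hh

theorem hasSum_norm_ampl {κ : Type} {M : κ → Ell X →L[ℂ] Ell X}
    (hM : ∀ x, HasSum (fun m => ‖M m x‖ ^ 2) (‖x‖ ^ 2)) (Φ : Y ≃ R × X) (f : Ell Y) :
    HasSum (fun m => ‖ampl Φ (M m) f‖ ^ 2) (‖f‖ ^ 2) := by
  have h1 := hasSum_norm_slice Φ f
  have h2 : ∀ r, HasSum (fun m => ‖M m (slice Φ r f)‖ ^ 2) (‖slice Φ r f‖ ^ 2) :=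
    fun r => hM (slice Φ r f)
  have h3 : ∀ m, HasSum (fun r => ‖M m (slice Φ r f)‖ ^ 2) (‖ampl Φ (M m) f‖ ^ 2) := fun m => by
    have := hasSum_norm_slice Φ (ampl Φ (M m) f)
    simpa only [slice_ampl] using this
  rw [← h1.tsum_eq]
  refine HasSum.swap_of_nonneg (f := fun p => ‖M p.1 (slice Φ p.2 f)‖ ^ 2)
    (fun _ => sq_nonneg _) h1.summable h3 h2

theorem ampl_eq_of_slice_eq {R' : Type} (Φ : Y ≃ R × X) (Ψ : Y ≃ R' × X)
    (h : ∀ y x, (Φ y).2 = (Ψ y).2 ∧ Φ.symm ((Φ y).1, x) = Ψ.symm ((Ψ y).1, x))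
    (A : Ell X →L[ℂ] Ell X) : ampl Φ A = ampl Ψ A := by
  ext f y
  have h1 : slice Φ (Φ y).1 f = slice Ψ (Ψ y).1 f := by
    ext x
    rw [slice_apply, slice_apply, (h y x).2]
  have h2 : ampl Φ A f y = A (slice Φ (Φ y).1 f) (Φ y).2 := rfl
  have h3 : ampl Ψ A f y = A (slice Ψ (Ψ y).1 f) (Ψ y).2 := rfl
  rw [h2, h3, h1, (h y (Ψ y).2).1]

theorem norm_adjoint_restr_le {j : X → Y} (hj : Function.Injective j) (f : Ell X) :
    ‖adjoint (restr j hj) f‖ ≤ ‖f‖ := by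
  have h : ‖adjoint (restr j hj)‖ ≤ 1 := by
    rw [LinearIsometryEquiv.norm_map]
    exact LinearMap.mkContinuous_norm_le _ zero_le_one _
  simpa using (adjoint (restr j hj)).le_of_opNorm_le h f

theorem ket_apply [DecidableEq X] (x y : X) : (ket x : Ell X) y = if y = x then 1 else 0 := by
  rw [← inner_ket_left, inner_ket_right]
  classical
  rw [ket]
  by_cases h : y = x
  · subst h
    simp
  · simp [h, Ne.symm h]

theorem restr_adjoint_restr {j : X → Y} (hj : Function.Injective j) (f : Ell X) :
    restr j hj (adjoint (restr j hj) f) = f := by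
  classical
  ext x
  have h1 : restr j hj (ket (j x)) = ket x := by
    ext x'
    have h2 : restr j hj (ket (j x)) x' = (ket (j x) : Ell Y) (j x') := rfl
    rw [h2, ket_apply, ket_apply]
    simp only [hj.eq_iff]
  have h3 : restr j hj (adjoint (restr j hj) f) x = adjoint (restr j hj) f (j x) := rfl
  rw [h3, ← inner_ket_left, adjoint_inner_right, h1, inner_ket_left]

end Ampl

/-! ## Operators on registers -/

section Registers

variable {G Γ Δ Θ : Ctx}

theorem hasSum_norm_rankOne_ket {X : Type} (o : X) (x : Ell X) :
    HasSum (fun i => ‖(rankOne ℂ (ket o) (ket i) : Ell X →L[ℂ] Ell X) x‖ ^ 2) (‖x‖ ^ 2) := by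
  have hn : ‖(ket o : Ell X)‖ = 1 := by
    rw [ket]
    simp
  simpa only [rankOne_apply, norm_smul, hn, mul_one, inner_ket_left] using x.hasSum_sq

theorem hasSum_norm_resetOp {t : QType} (q : Γ.Reg t) (x : Hil Γ) :
    HasSum (fun i => ‖resetOp q i x‖ ^ 2) (‖x‖ ^ 2) :=
  hasSum_norm_ampl (hasSum_norm_rankOne_ket _) _ x

theorem hasSum_norm_lift {κ : Type} (q : Emb Γ Δ) {M : κ → Op Γ}
    (hM : HasSum (fun m => ContinuousLinearMapWOT.ofCLM (star (M m) * M m))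
      (ContinuousLinearMapWOT.ofCLM 1)) (x : Hil Δ) :
    HasSum (fun m => ‖lift q (M m) x‖ ^ 2) (‖x‖ ^ 2) := by
  refine hasSum_norm_ampl (fun z => ?_) q.split x
  have h1 : HasSum (fun m => inner ℂ z ((star (M m) * M m) z)) (inner ℂ z z : ℂ) := by
    rw [HasSum, ContinuousLinearMapWOT.tendsto_iff_forall_inner_apply_tendsto] at hM
    refine (hM z z).congr fun S => ?_
    rw [← inner_sum]
    congr 1
    classical
    induction S using Finset.induction_on with
    | empty => simp
    | insert a S ha ih => rw [Finset.sum_insert ha, Finset.sum_insert ha, ← ih]; rfl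
  have h2 : ∀ w : Hil Γ, (inner ℂ w w : ℂ) = ((‖w‖ ^ 2 : ℝ) : ℂ) := fun w => by
    rw [inner_self_eq_norm_sq_to_K, ← RCLike.ofReal_pow]
    rfl
  simp only [mul_apply_eq_comp, star_eq_adjoint, adjoint_inner_right, h2] at h1
  exact Complex.hasSum_ofReal.1 h1

theorem star_lift_mul_lift (q : Emb Γ Δ) {U : Op Γ} (hU : U ∈ unitary (Op Γ)) :
    star (lift q U) * lift q U = 1 := by
  rw [lift, ← ampl_star, ← ampl_mul, (Unitary.mem_iff.1 hU).1, ampl_one]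

theorem norm_lift_le (q : Emb Γ Δ) {U : Op Γ} (hU : U ∈ unitary (Op Γ)) (x : Hil Δ) :
    ‖lift q U x‖ ≤ ‖x‖ := by
  have h : (inner ℂ (lift q U x) (lift q U x) : ℂ) = inner ℂ x x := by
    rw [← adjoint_inner_right, ← star_eq_adjoint, ← mul_apply_eq_comp, star_lift_mul_lift q hU,
      one_apply_eq_self]
  rw [inner_self_eq_norm_sq_to_K, inner_self_eq_norm_sq_to_K, ← RCLike.ofReal_pow,
    ← RCLike.ofReal_pow] at h
  exact le_of_eq ((sq_eq_sq₀ (norm_nonneg _) (norm_nonneg _)).1 (Complex.ofReal_injective h))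

/-- Labels for a scope extended by local variables. -/
def extendEquiv (G Γ Δ : Ctx) : State (G.sum (Γ.sum Δ)) ≃ State Δ × State (G.sum Γ) where
  toFun s := (fun t x => s t (Sum.inr (Sum.inr x)), fun t => Sum.elim (fun x => s t (Sum.inl x))
    fun x => s t (Sum.inr (Sum.inl x)))
  invFun p := State.extend p.1 p.2
  left_inv s := by
    funext t x
    rcases x with x | x | x <;> rfl
  right_inv p := by
    refine Prod.ext rfl ?_
    funext t x
    rcases x with x | x <;> rfl

theorem bra_eq_slice (d : State Δ) :
    (bra d : Hil (G.sum (Γ.sum Δ)) →L[ℂ] Hil (G.sum Γ)) = slice (extendEquiv G Γ Δ) d := rfl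

theorem hasSum_norm_bra (x : Hil (G.sum (Γ.sum Δ))) :
    HasSum (fun d : State Δ => ‖bra d x‖ ^ 2) (‖x‖ ^ 2) := by
  simpa only [bra_eq_slice] using hasSum_norm_slice (extendEquiv G Γ Δ) x

theorem lift_weaken (A : Op (G.sum Γ)) :
    lift (weaken G Γ Δ) A = ampl (extendEquiv G Γ Δ) A := by
  refine ampl_eq_of_slice_eq _ _ (fun y x => ⟨?_, ?_⟩) A
  · funext t z
    rcases z with z | z <;> rfl
  · rw [Equiv.symm_apply_eq]
    refine Prod.ext ?_ ?_
    · funext t z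
      obtain ⟨z, hz⟩ := z
      rcases z with z | z | z
      · exact absurd ⟨Sum.inl z, rfl⟩ hz
      · exact absurd ⟨Sum.inr z, rfl⟩ hz
      · rfl
    · funext t z
      rcases z with z | z <;> rfl

theorem norm_addKet_le (d : State Δ) (x : Hil (G.sum Γ)) :
    ‖(addKet d : Hil (G.sum Γ) →L[ℂ] Hil (G.sum (Γ.sum Δ))) x‖ ≤ ‖x‖ :=
  norm_adjoint_restr_le _ x

theorem bra_addKet (d : State Δ) (x : Hil (G.sum Γ)) :
    bra d ((addKet d : Hil (G.sum Γ) →L[ℂ] Hil (G.sum (Γ.sum Δ))) x) = x :=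
  restr_adjoint_restr _ x

theorem sum_norm_bra_le (x : Hil (G.sum (Γ.sum Δ))) (S : Finset (State Δ)) :
    ∑ d ∈ S, ‖bra d x‖ ^ 2 ≤ ‖x‖ ^ 2 :=
  sum_le_hasSum S (fun _ _ => by positivity) (hasSum_norm_bra x)

/-- The partial trace over the innermost local variables. -/
noncomputable def ptr (G Γ Δ : Ctx) : SOp (G.sum (Γ.sum Δ)) (G.sum Γ) :=
  fun ρ => wsum fun d : State Δ => conj (bra d) ρ

theorem isQOp_ptr : IsQOp (ptr G Γ Δ) :=
  isQOp_kraus (D := fun _ ρ => ρ) sum_norm_bra_le fun _ => isQOp_id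

theorem dual_ptr (A : Op (G.sum Γ)) : dual (ptr G Γ Δ) A = lift (weaken G Γ Δ) A := by
  refine ext_inner_right fun x y => ?_
  have h1 := hasSum_dual_kraus (K := bra (G := G) (Γ := Γ) (Δ := Δ)) (D := fun _ ρ => ρ)
    sum_norm_bra_le (fun _ => isQOp_id) A x y
  have h2 := hasSum_inner_slice (extendEquiv G Γ Δ) x (ampl (extendEquiv G Γ Δ) A y)
  simp only [slice_ampl] at h2
  simp only [← bra_eq_slice] at h2
  simp only [dual_id] at h1
  rw [lift_weaken]
  exact h1.unique h2

end Registers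

/-! ## The syntactic order on statements -/

section Programs

variable {G : Ctx} {π : Type} {Y : π → Ctx}

/-- `S'` results from `S` by replacing occurrences of `bot`. -/
inductive Stmt.Le : {Γ : Ctx} → Stmt G Y Γ → Stmt G Y Γ → Prop
  | bot {Γ : Ctx} (S : Stmt G Y Γ) : Stmt.Le .bot S
  | skip {Γ : Ctx} : Stmt.Le (.skip (Γ := Γ)) .skip
  | reset {Γ : Ctx} {t : QType} (q : (G.sum Γ).Reg t) : Stmt.Le (.reset q) (.reset q)
  | apply {Γ : Ctx} (τ : Ctx) (q : Emb τ (G.sum Γ)) (U : Op τ) (hU : U ∈ unitary (Op τ)) :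
      Stmt.Le (.apply τ q U hU) (.apply τ q U hU)
  | seq {Γ : Ctx} {S₁ S₂ S₁' S₂' : Stmt G Y Γ} (h₁ : Stmt.Le S₁ S₁') (h₂ : Stmt.Le S₂ S₂') :
      Stmt.Le (.seq S₁ S₂) (.seq S₁' S₂')
  | measure {Γ : Ctx} (τ : Ctx) (q : Emb τ (G.sum Γ)) (ι : Type) (M : ι → Op τ)
      (hM : HasSum (fun m => ContinuousLinearMapWOT.ofCLM (star (M m) * M m))
        (ContinuousLinearMapWOT.ofCLM 1))
      {S S' : ι → Stmt G Y Γ} (h : ∀ m, Stmt.Le (S m) (S' m)) :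
      Stmt.Le (.measure τ q ι M hM S) (.measure τ q ι M hM S')
  | block {Γ : Ctx} (Δ : Ctx) {S S' : Stmt G Y (Γ.sum Δ)} (h : Stmt.Le S S') :
      Stmt.Le (.block Δ S) (.block Δ S')
  | call {Γ : Ctx} (j : π) (a : Hom (Y j) (G.sum Γ)) : Stmt.Le (.call j a) (.call j a)

theorem Stmt.Le.subst {Γ : Ctx} {S S' : Stmt G Y Γ} (h : Stmt.Le S S') :
    ∀ {Γ' : Ctx} (a : Hom Γ (G.sum Γ')), Stmt.Le (S.subst a) (S'.subst a) := by
  induction h with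
  | bot S => exact fun a => .bot _
  | skip => exact fun a => .skip
  | reset q => exact fun a => .reset _
  | apply τ q U hU =>
    intro Γ' a
    simp only [Stmt.subst]
    split_ifs
    · exact .apply _ _ _ _
    · exact .bot _
  | seq _ _ ih₁ ih₂ => exact fun a => .seq (ih₁ a) (ih₂ a)
  | measure τ q ι M hM _ ih =>
    intro Γ' a
    simp only [Stmt.subst]
    split_ifs
    · exact .measure _ _ _ _ _ fun m => ih m a
    · exact .bot _
  | block Δ _ ih => exact fun a => .block Δ (ih _)
  | call j b => exact fun a => .call _ _

theorem Stmt.unfold_le {T T' : ∀ j, Stmt G noProc (Y j)} (hT : ∀ j, Stmt.Le (T j) (T' j))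
    {Γ : Ctx} (S : Stmt G Y Γ) : Stmt.Le (S.unfold T) (S.unfold T') := by
  induction S with
  | bot => exact .bot _
  | skip => exact .skip
  | reset q => exact .reset q
  | apply τ q U hU => exact .apply _ _ _ _
  | seq _ _ ih₁ ih₂ => exact .seq ih₁ ih₂
  | measure τ q ι M hM _ ih => exact .measure _ _ _ _ _ ih
  | block Δ _ ih => exact .block Δ ih
  | call j a => exact .seq .skip ((hT j).subst a)

theorem approx_le_succ (D : ∀ j, Stmt G Y (Y j)) (n : ℕ) (j : π) :
    Stmt.Le (approx D n j) (approx D (n + 1) j) := by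
  induction n generalizing j with
  | zero => exact .bot _
  | succ n ih => exact Stmt.unfold_le ih (D j)

/-! ## Denotations are quantum operations -/

variable {c : ∀ (Γ : Ctx) (j : π), Hom (Y j) (G.sum Γ) → SOp (G.sum Γ) (G.sum Γ)}

theorem denWith_reset {Γ : Ctx} {t : QType} (q : (G.sum Γ).Reg t) :
    denWith c (.reset q) = fun ρ => wsum fun i => conj (resetOp q i) ρ := rfl

theorem denWith_apply {Γ : Ctx} (τ : Ctx) (q : Emb τ (G.sum Γ)) (U : Op τ)
    (hU : U ∈ unitary (Op τ)) : denWith c (.apply τ q U hU) = conj (lift q U) := rfl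

theorem denWith_measure {Γ : Ctx} (τ : Ctx) (q : Emb τ (G.sum Γ)) (ι : Type) (M : ι → Op τ)
    (hM : HasSum (fun m => ContinuousLinearMapWOT.ofCLM (star (M m) * M m))
      (ContinuousLinearMapWOT.ofCLM 1)) (S : ι → Stmt G Y Γ) :
    denWith c (.measure τ q ι M hM S) =
      fun ρ => wsum fun m => denWith c (S m) (conj (lift q (M m)) ρ) := rfl

theorem denWith_block {Γ : Ctx} (Δ : Ctx) (S : Stmt G Y (Γ.sum Δ)) :
    denWith c (.block Δ S) =
      fun ρ => ptr G Γ Δ (denWith c S (conj (addKet (State.zero Δ)) ρ)) := by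
  funext ρ
  simp only [denWith, ptr, conj, addKet, adjoint_adjoint]

theorem sum_norm_resetOp_le {Γ : Ctx} {t : QType} (q : Γ.Reg t) (x : Hil Γ) (F : Finset _) :
    ∑ i ∈ F, ‖resetOp q i x‖ ^ 2 ≤ ‖x‖ ^ 2 :=
  sum_le_hasSum F (fun _ _ => by positivity) (hasSum_norm_resetOp q x)

theorem sum_norm_lift_le {κ : Type} {Γ Δ : Ctx} (q : Emb Γ Δ) {M : κ → Op Γ}
    (hM : HasSum (fun m => ContinuousLinearMapWOT.ofCLM (star (M m) * M m))
      (ContinuousLinearMapWOT.ofCLM 1)) (x : Hil Δ) (F : Finset κ) :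
    ∑ m ∈ F, ‖lift q (M m) x‖ ^ 2 ≤ ‖x‖ ^ 2 :=
  sum_le_hasSum F (fun _ _ => by positivity) (hasSum_norm_lift q hM x)

theorem isQOp_conj_addKet (Γ Δ : Ctx) : IsQOp (conj (addKet (G := G) (Γ := Γ) (State.zero Δ))) :=
  isQOp_conj (norm_addKet_le _)

theorem isQOp_denWith (hc : ∀ Γ j a, IsQOp (c Γ j a)) {Γ : Ctx} (S : Stmt G Y Γ) :
    IsQOp (denWith c S) := by
  induction S with
  | bot => exact isQOp_zero
  | skip => exact isQOp_id
  | reset q =>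
    rw [denWith_reset]
    exact isQOp_kraus (D := fun _ ρ => ρ) (sum_norm_resetOp_le q) fun _ => isQOp_id
  | apply τ q U hU =>
    rw [denWith_apply]
    exact isQOp_conj (norm_lift_le q hU)
  | seq _ _ ih₁ ih₂ => exact ih₂.comp ih₁
  | measure τ q ι M hM S ih =>
    rw [denWith_measure]
    exact isQOp_kraus (sum_norm_lift_le q hM) ih
  | block Δ S ih =>
    rw [denWith_block]
    exact isQOp_ptr.comp (ih.comp (isQOp_conj_addKet _ Δ))
  | call j a => exact hc _ j a

theorem denWith_mono (hc : ∀ Γ j a, IsQOp (c Γ j a)) {Γ : Ctx} {S S' : Stmt G Y Γ}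
    (h : Stmt.Le S S') :
    ∀ ρ ∈ TC (G.sum Γ), 0 ≤ ρ → denWith c S ρ ≤ denWith c S' ρ := by
  induction h with
  | bot S => exact fun ρ h h0 => (isQOp_denWith hc S).nonneg h h0
  | seq _ _ ih₁ ih₂ =>
    rename_i S₁ S₂ S₁' S₂' _ _
    intro ρ h h0
    have q₁ := isQOp_denWith hc S₁
    have q₁' := isQOp_denWith hc S₁'
    exact (ih₂ _ (q₁.map_tc ρ h) (q₁.nonneg h h0)).trans
      ((isQOp_denWith hc S₂').mono (q₁.map_tc ρ h) (q₁'.map_tc ρ h) (ih₁ ρ h h0))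
  | measure τ q ι M hM h ih =>
    intro ρ h h0
    rw [denWith_measure, denWith_measure]
    exact kraus_mono (sum_norm_lift_le q hM) (fun m => isQOp_denWith hc _)
      (fun m => isQOp_denWith hc _) ih h h0
  | block Δ h ih =>
    rename_i Γ S S'
    intro ρ h h0
    rw [denWith_block, denWith_block]
    have q := isQOp_conj_addKet (G := G) Γ Δ
    have hq := q.map_tc ρ h
    exact isQOp_ptr.mono ((isQOp_denWith hc S).map_tc _ hq) ((isQOp_denWith hc S').map_tc _ hq)
      (ih _ hq (q.nonneg h h0))
  | _ => exact fun ρ _ _ => le_rfl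

theorem isQOp_den₀ {Γ : Ctx} (S : Stmt G noProc Γ) : IsQOp (den₀ S) :=
  isQOp_denWith (fun _ j => j.elim) S

theorem monotone_den₀_approx (D : ∀ j, Stmt G Y (Y j)) {Γ : Ctx} (j : π)
    (a : Hom (Y j) (G.sum Γ)) :
    ∀ ρ ∈ TC (G.sum Γ), 0 ≤ ρ → Monotone fun n => den₀ ((approx D n j).subst a) ρ :=
  fun ρ h h0 => monotone_nat_of_le_succ fun n =>
    denWith_mono (fun _ j => j.elim) ((approx_le_succ D n j).subst a) ρ h h0

theorem isSup_call (D : ∀ j, Stmt G Y (Y j)) {Γ : Ctx} (j : π) (a : Hom (Y j) (G.sum Γ)) :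
    IsSup (fun n => den₀ ((approx D n j).subst a)) (sup fun n => den₀ ((approx D n j).subst a)) :=
  isSup_sup (fun _ => isQOp_den₀ _) (monotone_den₀_approx D j a)

theorem isQOp_den (D : ∀ j, Stmt G Y (Y j)) {Γ : Ctx} (S : Stmt G Y Γ) : IsQOp (den D S) :=
  isQOp_denWith (fun _ j a => (isSup_call D j a).1) S

end Programs

/-! ## Predicate terms -/

section Terms

variable {p : Set PVar} {Q : Ctx} {B : Base p Q} {Γ Δ : Ctx}

theorem PQPT.den_mk' {φ : Assign → Op Γ} (h : ∃ R : PQPT B Γ, ∀ v, R.den v = φ v) (v : Assign) :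
    (PQPT.mk' φ : PQPT B Γ).den v = φ v :=
  Classical.epsilon_spec (p := fun R : PQPT B Γ => ∀ v, R.den v = φ v) h v

theorem PQPT.exists_pull (P : PQPT B Δ) {T : SOp Γ Δ} (hT : IsQOp T) :
    ∃ R : PQPT B Γ, ∀ v, R.den v = dual T (P.den v) :=
  ⟨⟨fun ρ => P.E (T ρ), fun ρ => P.F (T ρ), P.hE.comp hT, P.hF.comp hT, fun ρ h h0 =>
    (P.tni _ (hT.map_tc ρ h) (hT.nonneg h h0)).trans (hT.tni ρ h h0)⟩, fun v => by
    rw [PQPT.den, PQPT.den, hT.dual_add, P.hE.dual_comp hT, P.hF.dual_comp hT]⟩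

theorem PQPT.exists_pull_liberal (P : PQPT B Δ) {T : SOp Γ Δ} (hT : IsQOp T) :
    ∃ R : PQPT B Γ, ∀ v, R.den v = dual T (P.den v) + (1 - dual T 1) := by
  obtain ⟨Z, hZ, hZ1⟩ := exists_dual_one_eq (L := 1 - dual T 1)
    (sub_nonneg.2 (dual_one_le_one hT)) (sub_le_self _ (dual_one_nonneg hT)) Q
  have htr : ∀ ρ ∈ TC Γ, (tr (Z ρ)).re = (tr ρ).re - (tr (T ρ)).re := by
    intro ρ h
    have h1 := hZ.tr_dual 1 ρ h
    rw [hZ1, tr_sub_mul _ _ h, ← hT.tr_dual 1 ρ h, one_mul, one_mul, one_mul] at h1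
    rw [h1, Complex.sub_re]
  have hsum : ∀ ρ ∈ TC Γ, 0 ≤ ρ →
      (tr (P.E (T ρ))).re + (tr (P.F (T ρ))).re ≤ (tr (T ρ)).re := fun ρ h h0 =>
    P.tni _ (hT.map_tc ρ h) (hT.nonneg h h0)
  have hF : IsQOp fun ρ => P.F (T ρ) + Z ρ := (P.hF.comp hT).add hZ fun ρ h h0 => by
    have := P.hF.tni _ (hT.map_tc ρ h) (hT.nonneg h h0)
    rw [htr ρ h]
    linarith
  refine ⟨⟨fun ρ => P.E (T ρ), _, P.hE.comp hT, hF, fun ρ h h0 => ?_⟩, fun v => ?_⟩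
  · have h1 := hsum ρ h h0
    have h2 := htr ρ h
    rw [tr_add (P.hF.map_tc _ (hT.map_tc ρ h)) (hZ.map_tc ρ h), Complex.add_re]
    linarith
  · rw [PQPT.den, PQPT.den]
    rw [(P.hF.comp hT).dual_add_left hZ, hT.dual_add, P.hE.dual_comp hT, P.hF.dual_comp hT, hZ1,
      add_assoc]

theorem PQPT.zero_den (v : Assign) : (0 : PQPT B Γ).den v = 0 := by
  refine PQPT.den_mk' ?_ v
  obtain ⟨R, hR⟩ := PQPT.exists_pull (Classical.arbitrary (PQPT B Γ)) (isQOp_zero (Γ := Γ))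
  exact ⟨R, fun v => by rw [hR, dual_zero]⟩

theorem PQPT.one_den (v : Assign) : (1 : PQPT B Γ).den v = 1 := by
  refine PQPT.den_mk' ?_ v
  obtain ⟨R, hR⟩ := PQPT.exists_pull_liberal (Classical.arbitrary (PQPT B Γ))
    (isQOp_zero (Γ := Γ))
  exact ⟨R, fun v => by rw [hR, dual_zero, dual_zero, sub_zero, zero_add]⟩

variable {E : ℕ → SOp Γ Γ} {E' : SOp Γ Γ} {P : PQPT B Γ} {Pn : ℕ → PQPT B Γ}

theorem den_upperLimit (hE : ∀ n, IsQOp (E n))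
    (hm : ∀ ρ ∈ TC Γ, 0 ≤ ρ → Monotone fun n => E n ρ) (hs : IsSup E E')
    (hP : ∀ n v, (Pn n).den v = dual (E n) (P.den v)) (v : Assign) :
    (upperLimit Pn).den v = dual E' (P.den v) := by
  obtain ⟨R, hR⟩ := P.exists_pull hs.1
  obtain ⟨P₁, E₁, E₁', hE₁, hm₁, hs₁, hP₁, hR₁⟩ := Classical.epsilon_spec
    (p := IsUpperLimit Pn)
    ⟨R, P, E, E', hE, fun n ρ h h0 => hm ρ h h0 n.le_succ, hs, hP, hR⟩
  have hm₁' := fun ρ h h0 => monotone_nat_of_le_succ fun n => hm₁ n ρ h h0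
  rw [upperLimit, hR₁]
  refine ext_inner_right fun x y => tendsto_nhds_unique
    ((hs₁.isWLim hE₁ hm₁').tendsto_dual hE₁ hm₁' (P₁.den v) x y) ?_
  simp only [← hP₁, hP]
  exact (hs.isWLim hE hm).tendsto_dual hE hm (P.den v) x y

theorem tendsto_dual_liberal (hE : ∀ n, IsQOp (E n))
    (hm : ∀ ρ ∈ TC Γ, 0 ≤ ρ → Monotone fun n => E n ρ) (hs : IsSup E E') (A : Op Γ)
    (x y : Hil Γ) :
    Tendsto (fun n => inner ℂ x ((dual (E n) A + (1 - dual (E n) 1)) y)) atTop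
      (𝓝 (inner ℂ x ((dual E' A + (1 - dual E' 1)) y))) := by
  have h := hs.isWLim hE hm
  simp only [_root_.add_apply, _root_.sub_apply, inner_add_right, inner_sub_right]
  exact (h.tendsto_dual hE hm A x y).add
    (tendsto_const_nhds.sub (h.tendsto_dual hE hm 1 x y))

theorem den_lowerLimit (hE : ∀ n, IsQOp (E n))
    (hm : ∀ ρ ∈ TC Γ, 0 ≤ ρ → Monotone fun n => E n ρ) (hs : IsSup E E')
    (hP : ∀ n v, (Pn n).den v = dual (E n) (P.den v) + (1 - dual (E n) 1)) (v : Assign) :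
    (lowerLimit Pn).den v = dual E' (P.den v) + (1 - dual E' 1) := by
  obtain ⟨R, hR⟩ := P.exists_pull_liberal hs.1
  obtain ⟨P₁, E₁, E₁', hE₁, hm₁, hs₁, hP₁, hR₁⟩ := Classical.epsilon_spec
    (p := IsLowerLimit Pn)
    ⟨R, P, E, E', hE, fun n ρ h h0 => hm ρ h h0 n.le_succ, hs, hP, hR⟩
  have hm₁' := fun ρ h h0 => monotone_nat_of_le_succ fun n => hm₁ n ρ h h0
  rw [lowerLimit, hR₁]
  refine ext_inner_right fun x y => tendsto_nhds_unique
    (tendsto_dual_liberal hE₁ hm₁' hs₁ (P₁.den v) x y) ?_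
  simp only [← hP₁, hP]
  exact tendsto_dual_liberal hE hm hs (P.den v) x y

end Terms

/-! ## Formal preconditions -/

section Preconditions

variable {p : Set PVar} {Q : Ctx} {B : Base p Q} {G : Ctx} {π : Type} {Y : π → Ctx}
  {c : ∀ (Γ : Ctx) (j : π), Hom (Y j) (G.sum Γ) → SOp (G.sum Γ) (G.sum Γ)}
  {f : ∀ (Γ : Ctx) (j : π), Hom (Y j) (G.sum Γ) → PQPT B (G.sum Γ) → PQPT B (G.sum Γ)}

theorem dual_reset {Γ : Ctx} {t : QType} (q : (G.sum Γ).Reg t) (A : Op (G.sum Γ)) :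
    (wsum fun i => star (resetOp q i) * A * resetOp q i) =
      dual (fun ρ => wsum fun i => conj (resetOp q i) ρ) A := by
  have := dual_kraus (D := fun _ ρ => ρ) (sum_norm_resetOp_le q) (fun _ => isQOp_id) A
  simp only [dual_id] at this
  exact this

theorem dual_reset_liberal {Γ : Ctx} {t : QType} (q : (G.sum Γ).Reg t) (A : Op (G.sum Γ)) :
    (wsum fun i => star (resetOp q i) * A * resetOp q i) =
      dual (fun ρ => wsum fun i => conj (resetOp q i) ρ) A +
        (1 - dual (fun ρ => wsum fun i => conj (resetOp q i) ρ) 1) := by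
  have := dual_kraus_liberal (D := fun _ ρ => ρ) (hasSum_norm_resetOp q) (fun _ => isQOp_id) A
  simp only [dual_id, sub_self, add_zero] at this
  exact this

theorem dual_lift {Γ τ : Ctx} (q : Emb τ Γ) {U : Op τ} (hU : U ∈ unitary (Op τ)) (A : Op Γ) :
    dual (conj (lift q U)) A = star (lift q U) * A * lift q U :=
  dual_conj (norm_lift_le q hU) A

theorem dual_conj_addKet {Γ : Ctx} (Δ : Ctx) (A : Op (G.sum (Γ.sum Δ))) :
    dual (conj (addKet (State.zero Δ))) A = bra (State.zero Δ) ∘L A ∘L addKet (State.zero Δ) := by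
  rw [dual_conj (norm_addKet_le _), addKet, adjoint_adjoint]

theorem den_mk'_lift_weaken {Γ : Ctx} (Δ : Ctx) (P : PQPT B (G.sum Γ)) (v : Assign) :
    (PQPT.mk' (fun v' => lift (weaken G Γ Δ) (P.den v')) : PQPT B _).den v =
      dual (ptr G Γ Δ) (P.den v) := by
  rw [dual_ptr]
  refine PQPT.den_mk' ?_ v
  obtain ⟨R, hR⟩ := P.exists_pull (isQOp_ptr (G := G) (Γ := Γ) (Δ := Δ))
  exact ⟨R, fun v => by rw [hR, dual_ptr]⟩

theorem den_fxpWith_zero (hc : ∀ Γ j a, IsQOp (c Γ j a))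
    (hf : ∀ Γ j a P v, (f Γ j a P).den v = dual (c Γ j a) (P.den v)) {Γ : Ctx} (S : Stmt G Y Γ) :
    ∀ (P : PQPT B (G.sum Γ)) v,
      (fxpWith (fun _ => 0) f S P).den v = dual (denWith c S) (P.den v) := by
  induction S with
  | bot => exact fun P v => by rw [fxpWith, PQPT.zero_den]; exact (dual_zero _).symm
  | skip => exact fun P v => (dual_id _).symm
  | reset q =>
    intro P v
    have hq := isQOp_denWith hc (.reset q)
    rw [denWith_reset] at hq ⊢
    simp only [fxpWith, dual_reset]
    exact PQPT.den_mk' (P.exists_pull hq) v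
  | apply τ q U hU =>
    intro P v
    have hq := isQOp_denWith hc (.apply τ q U hU)
    rw [denWith_apply] at hq ⊢
    simp only [fxpWith, ← dual_lift q hU]
    exact PQPT.den_mk' (P.exists_pull hq) v
  | seq S₁ S₂ ih₁ ih₂ =>
    intro P v
    rw [fxpWith, ih₁, ih₂]
    exact ((isQOp_denWith hc S₂).dual_comp (isQOp_denWith hc S₁) _).symm
  | measure τ q ι M hM S ih =>
    intro P v
    have hq := isQOp_denWith hc (.measure τ q ι M hM S)
    have hφ : ∀ v, (wsum fun m => star (lift q (M m)) * (fxpWith (fun _ => 0) f (S m) P).den v *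
        lift q (M m)) = dual (denWith c (.measure τ q ι M hM S)) (P.den v) := fun v => by
      rw [denWith_measure, ← dual_kraus (sum_norm_lift_le q hM) fun m => isQOp_denWith hc (S m)]
      simp only [ih]
      rfl
    simp only [fxpWith, hφ]
    exact PQPT.den_mk' (P.exists_pull hq) v
  | block Δ S ih =>
    intro P v
    have hq := isQOp_denWith hc (.block Δ S)
    have hS := isQOp_denWith hc S
    rename_i Γ
    have ha := isQOp_conj_addKet (G := G) Γ Δ
    simp only [fxpWith, ih, den_mk'_lift_weaken, ← dual_conj_addKet, ← hS.dual_comp ha,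
      ← isQOp_ptr.dual_comp (hS.comp ha)]
    rw [denWith_block] at hq ⊢
    exact PQPT.den_mk' (P.exists_pull hq) v
  | call j a => exact fun P v => hf _ j a P v

theorem den_fxpWith_one (hc : ∀ Γ j a, IsQOp (c Γ j a))
    (hf : ∀ Γ j a P v, (f Γ j a P).den v = dual (c Γ j a) (P.den v) + (1 - dual (c Γ j a) 1))
    {Γ : Ctx} (S : Stmt G Y Γ) :
    ∀ (P : PQPT B (G.sum Γ)) v, (fxpWith (fun _ => 1) f S P).den v =
      dual (denWith c S) (P.den v) + (1 - dual (denWith c S) 1) := by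
  induction S with
  | bot =>
    intro P v
    rw [fxpWith, PQPT.one_den]
    simp only [denWith, dual_zero, sub_zero, zero_add]
  | skip =>
    intro P v
    simp only [fxpWith, denWith, dual_id, sub_self, add_zero]
  | reset q =>
    intro P v
    have hq := isQOp_denWith hc (.reset q)
    rw [denWith_reset] at hq ⊢
    simp only [fxpWith, dual_reset_liberal]
    exact PQPT.den_mk' (P.exists_pull_liberal hq) v
  | apply τ q U hU =>
    intro P v
    have hq := isQOp_denWith hc (.apply τ q U hU)
    rw [denWith_apply] at hq ⊢
    have h1 : dual (conj (lift q U)) 1 = 1 := by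
      rw [dual_lift q hU, mul_one, star_lift_mul_lift q hU]
    simp only [fxpWith, ← dual_lift q hU, h1, sub_self, add_zero]
    exact PQPT.den_mk' (P.exists_pull hq) v
  | seq S₁ S₂ ih₁ ih₂ =>
    intro P v
    have h₁ := isQOp_denWith hc S₁
    have h := (isQOp_denWith hc S₂).dual_comp h₁
    have hd : denWith c (.seq S₁ S₂) = fun ρ => denWith c S₂ (denWith c S₁ ρ) := rfl
    rw [fxpWith, ih₁, ih₂, hd, h, h, h₁.dual_add, h₁.dual_sub]
    abel
  | measure τ q ι M hM S ih =>
    intro P v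
    have hq := isQOp_denWith hc (.measure τ q ι M hM S)
    have hφ : ∀ v, (wsum fun m => star (lift q (M m)) * (fxpWith (fun _ => 1) f (S m) P).den v *
        lift q (M m)) = dual (denWith c (.measure τ q ι M hM S)) (P.den v) +
          (1 - dual (denWith c (.measure τ q ι M hM S)) 1) := fun v => by
      rw [denWith_measure, ← dual_kraus_liberal (hasSum_norm_lift q hM)
        fun m => isQOp_denWith hc (S m)]
      simp only [ih]
      rfl
    simp only [fxpWith, hφ]
    exact PQPT.den_mk' (P.exists_pull_liberal hq) v
  | block Δ S ih =>
    intro P v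
    have hq := isQOp_denWith hc (.block Δ S)
    have hS := isQOp_denWith hc S
    rename_i Γ
    have ha := isQOp_conj_addKet (G := G) Γ Δ
    have ha1 : dual (conj (addKet (G := G) (Γ := Γ) (State.zero Δ))) 1 = 1 := by
      rw [dual_conj_addKet]
      ext1 x
      exact bra_addKet _ x
    have hp1 : dual (ptr G Γ Δ) 1 = 1 := by rw [dual_ptr, lift_weaken, ampl_one]
    have hφ : ∀ A, bra (State.zero Δ) ∘L (dual (denWith c S) (dual (ptr G Γ Δ) A) +
        (1 - dual (denWith c S) 1)) ∘L addKet (State.zero Δ) =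
          dual (denWith c (.block Δ S)) A + (1 - dual (denWith c (.block Δ S)) 1) := fun A => by
      rw [denWith_block, ← dual_conj_addKet, ha.dual_add, ha.dual_sub, ha1,
        isQOp_ptr.dual_comp (hS.comp ha), isQOp_ptr.dual_comp (hS.comp ha), hp1,
        hS.dual_comp ha, hS.dual_comp ha]
    simp only [fxpWith, ih, den_mk'_lift_weaken, hφ]
    exact PQPT.den_mk' (P.exists_pull_liberal hq) v
  | call j a => exact fun P v => hf _ j a P v

theorem den_fwp (D : ∀ j, Stmt G Y (Y j)) {Γ : Ctx} (S : Stmt G Y Γ) (P : PQPT B (G.sum Γ))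
    (v : Assign) : (fwp D S P).den v = dual (den D S) (P.den v) :=
  den_fxpWith_zero (fun _ j a => (isSup_call D j a).1) (fun _ j a P v =>
    den_upperLimit (P := P) (fun _ => isQOp_den₀ _) (monotone_den₀_approx D j a)
      (isSup_call D j a) (fun _ v => den_fxpWith_zero (fun _ j => j.elim) (fun _ j => j.elim) _ P v)
      v) S P v

theorem den_fwlp (D : ∀ j, Stmt G Y (Y j)) {Γ : Ctx} (S : Stmt G Y Γ) (P : PQPT B (G.sum Γ))
    (v : Assign) :
    (fwlp D S P).den v = dual (den D S) (P.den v) + (1 - dual (den D S) 1) :=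
  den_fxpWith_one (fun _ j a => (isSup_call D j a).1) (fun _ j a P v =>
    den_lowerLimit (P := P) (fun _ => isQOp_den₀ _) (monotone_den₀_approx D j a)
      (isSup_call D j a) (fun _ v => den_fxpWith_one (fun _ j => j.elim) (fun _ j => j.elim) _ P v)
      v) S P v

end Preconditions

end QHL

theorem mainTheorem6 {G : Ctx} {π : Type} {Y : π → Ctx} (D : ∀ j, Stmt G Y (Y j)) {Γ : Ctx}
    (S : Stmt G Y Γ) {p : Set PVar} {Q : Ctx} {B : Base p Q} (P : PQPT B (G.sum Γ)) :
    IsQOp (den D S) ∧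
    (∀ v, (fwp D S P).den v = dual (den D S) (P.den v)) ∧
    (∀ v, (fwlp D S P).den v =
      (fwp D S P).den v + (1 - (fwp D S (1 : PQPT B (G.sum Γ))).den v)) ∧
    (∀ {p' : Set PVar} {Q' : Ctx} {B' : Base p' Q'} (N : PQPT B' (G.sum Γ)),
      (∀ v, N.den v = 1 - P.den v) →
        ∀ v, (fwlp D S P).den v = 1 - (fwp D S N).den v) := by
  refine ⟨isQOp_den D S, den_fwp D S P, fun v => ?_, fun N hN v => ?_⟩
  · rw [den_fwlp, den_fwp, den_fwp, PQPT.one_den]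
  · rw [den_fwlp, den_fwp, hN, (isQOp_den D S).dual_sub]
    abel
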